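/- Fix $\beta>0$ and $c\ge 1$. For $n\ge1$ put $\alpha=\frac{c-1}{2}+\frac1{2n}-\frac1{\beta n}$ and let $(\lambda_1,\dots,\lambda_n)\in(0,\infty)^n$ be distributed according to the Wishart (Laguerre) $\beta$-ensemble law $$\frac1{\mathcal Z_n}\,e^{-\beta E[\boldsymbol\lambda]}\,d\lambda_1\cdots d\lambda_n,\qquad E[\boldsymbol\lambda]=-\frac12\sum_{i\ne j}\ln|\lambda_i-\lambda_j|+n\sum_k\Big(\frac{\lambda_k}{2}-\alpha\ln\lambda_k\Big),$$ where $\mathcal Z_n$ is the normalization constant (for $\beta=1,2,4$ and $m=cn$ an integer this is the law of the eigenvalues of $\frac1n\mathcal X\mathcal X^\dagger$ for an $n\times m$ real, complex or quaternion standard Gaussian matrix $\mathcal X$). Let $$H=\frac1n\sum_{i=1}^n\ln\lambda_i,\qquad T=\frac1n\sum_{i=1}^n\lambda_i,\qquad \widehat{\mathcal P}_n(s,w)=\mathbb E\big[e^{-\beta n^2(sH+wT)}\big],\qquad s_c=\frac{c-1}{2}.$$ Then for all $s\le s_c$ and $w>-1/2$ the expectation $\widehat{\mathcal P}_n(s,w)$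 is finite for every $n\ge1$, and the limit $$J(s,w)=-\lim_{n\to\infty}\frac1{\beta n^2}\ln\widehat{\mathcal P}_n(s,w)$$ exists and is given by $$J(s,w)=J_H(s)+J_T(w)-s\ln(1+2w),$$ where $J_H$ and $J_T$ are the individual cumulant generating functions of $H$ and $T$, given explicitly by $$J_H(s)=-\lim_{n\to\infty}\frac1{\beta n^2}\ln\widehat{\mathcal P}_n(s,0)=\phi(s-s_c)-\phi(-s_c)\quad(s\le s_c),$$ $$J_T(w)=-\lim_{n\to\infty}\frac1{\beta n^2}\ln\widehat{\mathcal P}_n(0,w)=\frac c2\ln(1+2w)\quad(w>-1/2),$$ with $\phi(x)=-\frac32x+x^2\ln(-2x)-\frac{(1-2x)^2}{4}\ln(1-2x)$ for $x\le0$ (and $\phi(0)=0$). -/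

import Mathlib

open MeasureTheory Filter Topology

noncomputable section

namespace LaguerreGas

/-- The exponent `α = (c - 1)/2 + 1/(2n) - 1/(βn)` of the external potential. -/
def alpha (β c : ℝ) (n : ℕ) : ℝ :=
  (c - 1) / 2 + 1 / (2 * (n : ℝ)) - 1 / (β * (n : ℝ))

/-- The external potential `V(x) = x/2 - α ln x` (used for `x > 0` only). -/
def potential (β c : ℝ) (n : ℕ) (x : ℝ) : ℝ :=
  x / 2 - alpha β c n * Real.log x

/-- The energy `E[x] = -(1/2) ∑_{i ≠ j} ln |x_i - x_j| + n ∑_k V(x_k)`. -/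
def energy (β c : ℝ) (n : ℕ) (x : Fin n → ℝ) : ℝ :=
  -(1 / 2) * ∑ p ∈ (Finset.univ : Finset (Fin n)).offDiag, Real.log |x p.1 - x p.2|
    + (n : ℝ) * ∑ k, potential β c n (x k)

/-- The configurations of `n` distinct particles on the open positive half-line. Off this set the
energy is `+∞` (a particle at a negative position, or two particles at the same place), up to a
Lebesgue-null set (some particle at the origin). -/
def configurations (n : ℕ) : Set (Fin n → ℝ) :=
  {x | (∀ i, 0 < x i) ∧ Function.Injective x}

/-- The Boltzmann weight `exp (-β E[x])`, zero where the energy is infinite. -/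
def boltzmannWeight (β c : ℝ) (n : ℕ) : (Fin n → ℝ) → ℝ :=
  (configurations n).indicator fun x => Real.exp (-β * energy β c n x)

/-- The normalization constant `Z_n = ∫ exp (-β E[x]) dx`. -/
def partitionFunction (β c : ℝ) (n : ℕ) : ENNReal :=
  ∫⁻ x : Fin n → ℝ, ENNReal.ofReal (boltzmannWeight β c n x)

/-- The joint law `Z_n⁻¹ exp (-β E[x]) dx` of the eigenvalues. -/
def eigenvalueLaw (β c : ℝ) (n : ℕ) : Measure (Fin n → ℝ) :=
  (partitionFunction β c n)⁻¹ •
    (volume : Measure (Fin n → ℝ)).withDensity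
      fun x => ENNReal.ofReal (boltzmannWeight β c n x)

/-- The scaled log-determinant `H = (1/n) ∑ ln x_i`. -/
def logDet (n : ℕ) (x : Fin n → ℝ) : ℝ := (1 / (n : ℝ)) * ∑ i, Real.log (x i)

/-- The scaled trace `T = (1/n) ∑ x_i`. -/
def scaledTrace (n : ℕ) (x : Fin n → ℝ) : ℝ := (1 / (n : ℝ)) * ∑ i, x i

/-- The random variable `exp (-β n² (s H + w T))`. -/
def tilt (β : ℝ) (n : ℕ) (s w : ℝ) (x : Fin n → ℝ) : ℝ :=
  Real.exp (-β * (n : ℝ) ^ 2 * (s * logDet n x + w * scaledTrace n x))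

/-- The joint Laplace transform `⟨exp (-β n² (s H + w T))⟩`. -/
def laplace (β c : ℝ) (n : ℕ) (s w : ℝ) : ℝ :=
  ∫ x, tilt β n s w x ∂(eigenvalueLaw β c n)

/-- `-(1/(β n²)) ln ⟨exp (-β n² (s H + w T))⟩`. -/
def scaledLogLaplace (β c : ℝ) (n : ℕ) (s w : ℝ) : ℝ :=
  -(1 / (β * (n : ℝ) ^ 2)) * Real.log (laplace β c n s w)

/-- The critical value `s_c = (c - 1)/2`. -/
def sCrit (c : ℝ) : ℝ := (c - 1) / 2

/-- `φ(x) = -(3/2) x + x² ln (-2x) - ((1 - 2x)²/4) ln (1 - 2x)` for `x ≤ 0`,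
with `0² ln 0 = 0`. -/
def phi (x : ℝ) : ℝ :=
  -(3 / 2) * x + x ^ 2 * Real.log (-2 * x) - (1 - 2 * x) ^ 2 / 4 * Real.log (1 - 2 * x)

/-- `J_H(s) = φ(s - s_c) - φ(-s_c)`. -/
def JH (c s : ℝ) : ℝ := phi (s - sCrit c) - phi (-sCrit c)

/-- `J_T(w) = (c/2) ln (1 + 2w)`. -/
def JT (c w : ℝ) : ℝ := c / 2 * Real.log (1 + 2 * w)

end LaguerreGas

end

noncomputable section

namespace LaguerreGas

/-! The tilt by `s H + w T` does not leave the Laguerre family. It only changes the wall exponent to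
`b = β n (s_c - s) + β / 2` and the decay rate to `κ = (β n / 2) (1 + 2 w)`
(`boltzmannWeight_mul_tilt`). Rescaling all particles by `κ` extracts `κ` exactly at finite `n`,
which gives the terms in `ln (1 + 2 w)`. What remains is the ratio of `laguerreIntegral n (β / 2)`
at two values of its parameter, both of order at most `n` (`scaledLogLaplace_eq`).

No closed product of Gamma functions and no Stirling formula is used; the ratio is controlled in the
style of Bohr–Mollerup. Aomoto's integration by parts against elementary symmetric polynomials
yields the unit shift `L (a + 1) = L a * ∏ j < n, (a + j θ)` (`laguerreIntegral_add_one`), and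
Hölder's inequality makes `ln L` convex (`convexOn_log_laguerreIntegral`). Convexity and the unit
increments together force `ln L` to follow `freeEnergyApprox`, obtained by replacing sums of
logarithms by integrals (`abs_sub_freeEnergyApprox_le`). For parameters of order `n` the error is
`O(n ln n)`, negligible against `n ^ 2`.

Finally `freeEnergyApprox` is evaluated through the second primitive of the logarithm; its
increments give `phi`, and the divergent `ln (β n / 2)` contributions cancel those coming from the
rescaling. -/

/-- The elementary symmetric polynomial of degree `k` in the coordinates indexed by `s`. -/
def esymmOn {ι : Type*} (s : Finset ι) (k : ℕ) (x : ι → ℝ) : ℝ :=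
  ∑ t ∈ s.powersetCard k, ∏ i ∈ t, x i

/-! ### Elementary symmetric polynomials with variables deleted -/

section esymm

variable {ι : Type*}

lemma esymmOn_zero (s : Finset ι) (x : ι → ℝ) : esymmOn s 0 x = 1 := by
  simp [esymmOn]

lemma esymmOn_card (s : Finset ι) (x : ι → ℝ) : esymmOn s s.card x = ∏ i ∈ s, x i := by
  simp [esymmOn]

lemma continuous_esymmOn (s : Finset ι) (k : ℕ) : Continuous (esymmOn s k) := by
  unfold esymmOn; fun_prop

lemma esymmOn_nonneg (s : Finset ι) (k : ℕ) {x : ι → ℝ} (hx : ∀ i, 0 ≤ x i) :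
    0 ≤ esymmOn s k x :=
  Finset.sum_nonneg fun _ _ => Finset.prod_nonneg fun i _ => hx i

lemma esymmOn_le (s : Finset ι) [Fintype ι] (k : ℕ) {x : ι → ℝ} (hx : ∀ i, 0 ≤ x i) :
    esymmOn s k x ≤ ∏ i, (1 + x i) := by
  rw [Finset.prod_one_add]
  exact Finset.sum_le_sum_of_subset_of_nonneg
    (fun t _ => by simp)
    fun _ _ _ => Finset.prod_nonneg fun i _ => hx i

variable [DecidableEq ι]

lemma esymmOn_insert {s : Finset ι} {i : ι} (hi : i ∉ s) (k : ℕ) (x : ι → ℝ) :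
    esymmOn (insert i s) (k + 1) x = esymmOn s (k + 1) x + x i * esymmOn s k x := by
  unfold esymmOn
  rw [Finset.powersetCard_succ_insert hi, Finset.sum_union, Finset.sum_image, Finset.mul_sum]
  · congr 1
    refine Finset.sum_congr rfl fun t ht => ?_
    rw [Finset.prod_insert]
    exact fun h => hi ((Finset.mem_powersetCard.1 ht).1 h)
  · intro t ht u hu h
    have h1 : i ∉ t := fun h => hi ((Finset.mem_powersetCard.1 ht).1 h)
    have h2 : i ∉ u := fun h => hi ((Finset.mem_powersetCard.1 hu).1 h)
    rw [← Finset.erase_insert h1, ← Finset.erase_insert h2, h]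
  · rw [Finset.disjoint_left]
    intro t ht ht'
    obtain ⟨u, -, rfl⟩ := Finset.mem_image.1 ht'
    exact hi ((Finset.mem_powersetCard.1 ht).1 (Finset.mem_insert_self _ _))

lemma esymmOn_erase {s : Finset ι} {i : ι} (hi : i ∈ s) (k : ℕ) (x : ι → ℝ) :
    esymmOn s (k + 1) x = esymmOn (s.erase i) (k + 1) x + x i * esymmOn (s.erase i) k x := by
  conv_lhs => rw [← Finset.insert_erase hi]
  exact esymmOn_insert (Finset.notMem_erase i s) k x

/-- Double counting: each `k`-subset of `s` survives the deletion of `i` exactly for the `s.card -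
k` indices outside it. -/
lemma sum_esymmOn_erase (s : Finset ι) (k : ℕ) (x : ι → ℝ) :
    ∑ i ∈ s, esymmOn (s.erase i) k x = ((s.card : ℝ) - k) * esymmOn s k x := by
  unfold esymmOn
  have h : ∀ i ∈ s, ∑ t ∈ (s.erase i).powersetCard k, ∏ j ∈ t, x j
      = ∑ t ∈ s.powersetCard k, if i ∉ t then ∏ j ∈ t, x j else 0 := by
    intro i _
    rw [← Finset.sum_filter]
    refine Finset.sum_congr ?_ fun _ _ => rfl
    ext t
    simp only [Finset.mem_powersetCard, Finset.mem_filter, Finset.subset_erase]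
    tauto
  rw [Finset.sum_congr rfl h, Finset.sum_comm, Finset.mul_sum]
  refine Finset.sum_congr rfl fun t ht => ?_
  obtain ⟨hts, rfl⟩ := Finset.mem_powersetCard.1 ht
  rw [← Finset.sum_filter, Finset.sum_const, nsmul_eq_mul]
  congr 1
  have : s.filter (fun i => i ∉ t) = s \ t := by ext; simp
  rw [this, Finset.card_sdiff_of_subset hts, Nat.cast_sub (Finset.card_le_card hts)]

lemma sum_mul_esymmOn_erase (s : Finset ι) (k : ℕ) (x : ι → ℝ) :
    ∑ i ∈ s, x i * esymmOn (s.erase i) k x = ((k : ℝ) + 1) * esymmOn s (k + 1) x := by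
  have h1 := sum_esymmOn_erase s (k + 1) x
  have h2 : ∑ i ∈ s, esymmOn s (k + 1) x
      = ∑ i ∈ s, (esymmOn (s.erase i) (k + 1) x + x i * esymmOn (s.erase i) k x) :=
    Finset.sum_congr rfl fun i hi => esymmOn_erase hi k x
  rw [Finset.sum_add_distrib, h1, Finset.sum_const, nsmul_eq_mul] at h2
  push_cast at h2
  linarith

lemma sum_offDiag_esymmOn_erase (s : Finset ι) (k : ℕ) (x : ι → ℝ) :
    ∑ p ∈ s.offDiag, esymmOn ((s.erase p.1).erase p.2) k x
      = ((s.card : ℝ) - k) * ((s.card : ℝ) - 1 - k) * esymmOn s k x := by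
  have h : ∑ p ∈ s.offDiag, esymmOn ((s.erase p.1).erase p.2) k x
      = ∑ i ∈ s, ∑ j ∈ s.erase i, esymmOn ((s.erase i).erase j) k x := by
    rw [Finset.sum_sigma']
    refine Finset.sum_bij' (fun p _ => ⟨p.1, p.2⟩) (fun p _ => (p.1, p.2)) ?_ ?_ ?_ ?_ ?_
    · simp; tauto
    · simp; tauto
    · simp
    · simp
    · simp
  rw [h]
  have h' : ∀ i ∈ s, ∑ j ∈ s.erase i, esymmOn ((s.erase i).erase j) k x
      = ((s.card : ℝ) - 1 - k) * esymmOn (s.erase i) k x := by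
    intro i hi
    rw [sum_esymmOn_erase, Finset.card_erase_of_mem hi,
      Nat.cast_sub (Finset.card_pos.2 ⟨i, hi⟩), Nat.cast_one]
  rw [Finset.sum_congr rfl h', ← Finset.mul_sum, sum_esymmOn_erase]
  ring

/-- The terms containing both variables are common to the two products and cancel. The factor `x i -
x j` left over compensates the singular denominator in the logarithmic derivative of the
interaction. -/
lemma mul_esymmOn_erase_sub (s : Finset ι) {i j : ι} (hi : i ∈ s) (hj : j ∈ s) (hij : i ≠ j)
    (k : ℕ) (x : ι → ℝ) :
    x i * esymmOn (s.erase i) k x - x j * esymmOn (s.erase j) k x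
      = (x i - x j) * esymmOn ((s.erase i).erase j) k x := by
  cases k with
  | zero => simp [esymmOn_zero]
  | succ k =>
    rw [esymmOn_erase (Finset.mem_erase.2 ⟨hij.symm, hj⟩) k x,
      esymmOn_erase (s := s.erase j) (Finset.mem_erase.2 ⟨hij, hi⟩) k x,
      Finset.erase_right_comm (a := j)]
    ring

lemma esymmOn_update (s : Finset ι) (k : ℕ) (x : ι → ℝ) {i : ι} (hi : i ∉ s) (t : ℝ) :
    esymmOn s k (Function.update x i t) = esymmOn s k x := by
  unfold esymmOn
  refine Finset.sum_congr rfl fun u hu => Finset.prod_congr rfl fun j hj => ?_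
  rw [Function.update_of_ne]
  rintro rfl
  exact hi ((Finset.mem_powersetCard.1 hu).1 hj)

end esymm

/-! ### Integration by parts against the product gamma density -/

/-- Lebesgue measure on the positive orthant. -/
def orthant (n : ℕ) : Measure (Fin n → ℝ) :=
  Measure.pi fun _ => volume.restrict (Set.Ioi (0 : ℝ))

lemma orthant_eq_restrict (n : ℕ) :
    orthant n = volume.restrict (Set.univ.pi fun _ : Fin n => Set.Ioi (0 : ℝ)) := by
  rw [orthant, volume_pi, Measure.restrict_pi_pi]

lemma ae_orthant_pos (n : ℕ) : ∀ᵐ x ∂orthant n, ∀ i, 0 < x i := by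
  rw [orthant_eq_restrict]
  filter_upwards [ae_restrict_mem (MeasurableSet.univ_pi fun _ => measurableSet_Ioi)] with x hx i
  exact hx i (Set.mem_univ i)

/-- The product of the gamma densities `t ^ (a - 1) * exp (-t)`. -/
def gammaProd (n : ℕ) (a : ℝ) (x : Fin n → ℝ) : ℝ :=
  ∏ i, (x i ^ (a - 1) * Real.exp (-x i))

lemma gammaProd_pos {n : ℕ} (a : ℝ) {x : Fin n → ℝ} (hx : ∀ i, 0 < x i) : 0 < gammaProd n a x :=
  Finset.prod_pos fun i _ => mul_pos (Real.rpow_pos_of_pos (hx i) _) (Real.exp_pos _)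

lemma measurable_gammaProd (n : ℕ) (a : ℝ) : Measurable (gammaProd n a) := by
  unfold gammaProd; fun_prop

/-- The integrand is the derivative of `t ^ a * exp (-t) * h t`. This vanishes at `0` since `a > 0`,
and at infinity since both it and its derivative are integrable. -/
lemma integral_Ioi_gamma_byParts {a : ℝ} (ha : 0 < a) {h h' : ℝ → ℝ}
    (hd : ∀ t, HasDerivAt h (h' t) t)
    (hi : IntegrableOn (fun t => t * h t * (t ^ (a - 1) * Real.exp (-t))) (Set.Ioi 0))
    (hi' : IntegrableOn (fun t => ((a - t) * h t + t * h' t) * (t ^ (a - 1) * Real.exp (-t)))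
      (Set.Ioi 0)) :
    ∫ t in Set.Ioi (0 : ℝ), ((a - t) * h t + t * h' t) * (t ^ (a - 1) * Real.exp (-t)) = 0 := by
  set f : ℝ → ℝ := fun t => t ^ a * Real.exp (-t) * h t with hf
  have hpow : ∀ t : ℝ, 0 < t → t ^ a = t * t ^ (a - 1) := fun t ht => by
    rw [Real.rpow_sub_one ht.ne']; field_simp
  have hderiv : ∀ t ∈ Set.Ioi (0 : ℝ), HasDerivAt f
      (((a - t) * h t + t * h' t) * (t ^ (a - 1) * Real.exp (-t))) t := by
    intro t ht
    have ht : 0 < t := ht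
    have h1 := Real.hasDerivAt_rpow_const (x := t) (p := a) (Or.inl ht.ne')
    have h2 : HasDerivAt (fun t : ℝ => Real.exp (-t)) (Real.exp (-t) * (-1)) t :=
      ((hasDerivAt_id t).neg).exp
    have h3 := (h1.mul h2).mul (hd t)
    refine h3.congr_deriv ?_
    simp only [Pi.mul_apply]
    rw [hpow t ht]
    ring
  have hfi : IntegrableOn f (Set.Ioi 0) := by
    refine hi.congr_fun (fun t ht => ?_) measurableSet_Ioi
    simp only [hf]
    rw [hpow t ht]; ring
  have hlim := tendsto_zero_of_hasDerivAt_of_integrableOn_Ioi hderiv hi' hfi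
  have hcont : ContinuousWithinAt f (Set.Ici 0) 0 := by
    refine ContinuousAt.continuousWithinAt ?_
    have := (Real.continuous_rpow_const ha.le).continuousAt (x := 0)
    exact (this.mul (by fun_prop)).mul (hd 0).continuousAt
  rw [integral_Ioi_of_hasDerivAt_of_tendsto hcont hderiv hi' hlim]
  simp [hf, Real.zero_rpow ha.ne']

/-- Integration by parts against the product gamma density in one coordinate. -/
lemma integral_gammaProd_byParts {n : ℕ} {a : ℝ} (ha : 0 < a) (i : Fin n)
    {H H' : (Fin n → ℝ) → ℝ}
    (hd : ∀ x, HasDerivAt (fun t => H (Function.update x i t)) (H' x) (x i))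
    (hi : Integrable (fun x => x i * H x * gammaProd n a x) (orthant n))
    (hi' : Integrable (fun x => ((a - x i) * H x + x i * H' x) * gammaProd n a x) (orthant n)) :
    ∫ x, ((a - x i) * H x + x i * H' x) * gammaProd n a x ∂orthant n = 0 := by
  cases n with
  | zero => exact i.elim0
  | succ m =>
    have hmp := (measurePreserving_piFinSuccAbove
      (fun _ : Fin (m + 1) => volume.restrict (Set.Ioi (0 : ℝ))) i).symm
    have hemb := (MeasurableEquiv.piFinSuccAbove (fun _ : Fin (m + 1) => ℝ) i).symm.measurableEmbedding
    have j := (hmp.integrable_comp_emb hemb).2 hi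
    have j' := (hmp.integrable_comp_emb hemb).2 hi'
    change ∫ x, _ ∂Measure.pi _ = 0
    rw [← hmp.integral_comp hemb]
    -- Fubini with coordinate `i` integrated first: the inner integral vanishes for almost every
    -- value of the other coordinates.
    refine (integral_prod_symm _ j').trans ?_
    rw [integral_eq_zero_of_ae]
    filter_upwards [j.prod_left_ae, j'.prod_left_ae] with y hy hy'
    have e0 : ∀ t, Fin.insertNthEquiv (fun _ : Fin (m + 1) => ℝ) i (t, y) = i.insertNth t y :=
      fun _ => rfl
    simp only [Function.comp_apply, e0, MeasurableEquiv.piFinSuccAbove_symm_apply,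
      Fin.insertNth_apply_same, gammaProd, Fin.prod_univ_succAbove _ i,
      Fin.insertNth_apply_succAbove, Pi.zero_apply] at hy hy' ⊢
    set K := ∏ j, (y j ^ (a - 1) * Real.exp (-y j))
    have e1 : ∀ t : ℝ, ((a - t) * H (i.insertNth t y) + t * H' (i.insertNth t y))
        * (t ^ (a - 1) * Real.exp (-t) * K)
        = ((a - t) * (H (i.insertNth t y) * K) + t * (H' (i.insertNth t y) * K))
          * (t ^ (a - 1) * Real.exp (-t)) := fun t => by ring
    have e2 : ∀ t : ℝ, t * H (i.insertNth t y) * (t ^ (a - 1) * Real.exp (-t) * K)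
        = t * (H (i.insertNth t y) * K) * (t ^ (a - 1) * Real.exp (-t)) := fun t => by ring
    simp only [e1] at hy' ⊢
    simp only [e2] at hy
    refine integral_Ioi_gamma_byParts ha (h := fun t => H (i.insertNth t y) * K)
      (h' := fun t => H' (i.insertNth t y) * K) (fun t => ?_) hy hy'
    have := hd (i.insertNth t y)
    simp only [Fin.update_insertNth, Fin.insertNth_apply_same] at this
    exact this.mul_const K

/-! ### Polynomial growth and integrability -/

/-- Measurable functions with at most polynomial growth on the positive orthant. -/
def PolyBounded {n : ℕ} (H : (Fin n → ℝ) → ℝ) : Prop :=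
  Measurable H ∧ ∃ C N : ℝ, 0 ≤ C ∧ 0 ≤ N ∧
    ∀ x : Fin n → ℝ, (∀ i, 0 < x i) → |H x| ≤ C * (∏ i, (1 + x i)) ^ N

lemma one_le_finsetProd_one_add {n : ℕ} {x : Fin n → ℝ} (s : Finset (Fin n))
    (hx : ∀ i, 0 < x i) : 1 ≤ ∏ i ∈ s, (1 + x i) := by
  simpa using Finset.prod_le_prod (s := s) (f := fun _ => (1 : ℝ)) (g := fun i => 1 + x i)
    (fun _ _ => zero_le_one) fun i _ => by linarith [hx i]

lemma one_le_prod_one_add {n : ℕ} {x : Fin n → ℝ} (hx : ∀ i, 0 < x i) : 1 ≤ ∏ i, (1 + x i) :=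
  one_le_finsetProd_one_add Finset.univ hx

lemma one_add_le_prod {n : ℕ} {x : Fin n → ℝ} (hx : ∀ i, 0 < x i) (i : Fin n) :
    1 + x i ≤ ∏ i, (1 + x i) := by
  rw [← Finset.mul_prod_erase _ _ (Finset.mem_univ i)]
  exact le_mul_of_one_le_right (by linarith [hx i])
    (one_le_finsetProd_one_add _ hx)

namespace PolyBounded

variable {n : ℕ} {F H : (Fin n → ℝ) → ℝ}

lemma mul (hF : PolyBounded F) (hH : PolyBounded H) : PolyBounded fun x => F x * H x := by
  obtain ⟨mF, C, N, hC, hN, hF⟩ := hF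
  obtain ⟨mH, D, M, hD, hM, hH⟩ := hH
  refine ⟨mF.mul mH, C * D, N + M, by positivity, by positivity, fun x hx => ?_⟩
  have hP := one_le_prod_one_add hx
  rw [abs_mul, Real.rpow_add (by linarith), mul_mul_mul_comm]
  exact mul_le_mul (hF x hx) (hH x hx) (abs_nonneg _) ((abs_nonneg _).trans (hF x hx))

lemma add (hF : PolyBounded F) (hH : PolyBounded H) : PolyBounded fun x => F x + H x := by
  obtain ⟨mF, C, N, hC, hN, hF⟩ := hF
  obtain ⟨mH, D, M, hD, hM, hH⟩ := hH
  refine ⟨mF.add mH, C + D, N + M, by positivity, by positivity, fun x hx => ?_⟩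
  have hP := one_le_prod_one_add hx
  have h1 : C * (∏ i, (1 + x i)) ^ N ≤ C * (∏ i, (1 + x i)) ^ (N + M) :=
    mul_le_mul_of_nonneg_left (Real.rpow_le_rpow_of_exponent_le hP (by linarith)) hC
  have h2 : D * (∏ i, (1 + x i)) ^ M ≤ D * (∏ i, (1 + x i)) ^ (N + M) :=
    mul_le_mul_of_nonneg_left (Real.rpow_le_rpow_of_exponent_le hP (by linarith)) hD
  have := abs_add_le (F x) (H x)
  have := hF x hx
  have := hH x hx
  linarith

lemma const (c : ℝ) : PolyBounded fun _ : Fin n → ℝ => c :=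
  ⟨measurable_const, |c|, 0, abs_nonneg c, le_rfl, fun x _ => by simp⟩

lemma coord (i : Fin n) : PolyBounded fun x : Fin n → ℝ => x i := by
  refine ⟨measurable_pi_apply i, 1, 1, by norm_num, by norm_num, fun x hx => ?_⟩
  rw [abs_of_pos (hx i), Real.rpow_one, one_mul]
  linarith [one_add_le_prod hx i]

lemma sub (hF : PolyBounded F) (hH : PolyBounded H) : PolyBounded fun x => F x - H x := by
  simpa [sub_eq_add_neg] using hF.add ((const (-1)).mul hH)

lemma sum {ι : Type*} (s : Finset ι) {F : ι → (Fin n → ℝ) → ℝ} (h : ∀ i ∈ s, PolyBounded (F i)) :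
    PolyBounded fun x => ∑ i ∈ s, F i x := by
  classical
  induction s using Finset.induction_on with
  | empty => simpa using const 0
  | insert i s hi ih =>
    simp only [Finset.sum_insert hi]
    exact (h i (Finset.mem_insert_self _ _)).add
      (ih fun j hj => h j (Finset.mem_insert_of_mem hj))

lemma esymmOn (s : Finset (Fin n)) (k : ℕ) : PolyBounded (esymmOn s k) := by
  refine ⟨(continuous_esymmOn s k).measurable, 1, 1, by norm_num, by norm_num, fun x hx => ?_⟩
  rw [abs_of_nonneg (esymmOn_nonneg s k fun i => (hx i).le), Real.rpow_one, one_mul]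
  exact esymmOn_le s k fun i => (hx i).le

lemma mono (hF : PolyBounded F) (hH : Measurable H)
    (h : ∀ x : Fin n → ℝ, (∀ i, 0 < x i) → |H x| ≤ |F x|) : PolyBounded H := by
  obtain ⟨-, C, N, hC, hN, hF⟩ := hF
  exact ⟨hH, C, N, hC, hN, fun x hx => (h x hx).trans (hF x hx)⟩

end PolyBounded

/-- The bound `(1 + t) ^ N ≤ 2 ^ N * (1 + t ^ N)` reduces this to the Gamma integrals at `a` and `a
+ N`. -/
lemma integrableOn_one_add_rpow_gamma {a N : ℝ} (ha : 0 < a) (hN : 0 ≤ N) :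
    IntegrableOn (fun t : ℝ => (1 + t) ^ N * (t ^ (a - 1) * Real.exp (-t))) (Set.Ioi 0) := by
  have h1 := Real.GammaIntegral_convergent ha
  have h2 := Real.GammaIntegral_convergent (s := a + N) (by positivity)
  refine Integrable.mono' ((h1.add h2).const_mul (2 ^ N)) ?_ ?_
  · exact Measurable.aestronglyMeasurable (by fun_prop)
  · filter_upwards [ae_restrict_mem measurableSet_Ioi] with t ht
    have ht : 0 < t := ht
    rw [Real.norm_of_nonneg (by positivity)]
    have h3 : (1 + t) ^ N ≤ 2 ^ N * (1 + t ^ N) := by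
      rcases le_total t 1 with h | h
      · calc (1 + t) ^ N ≤ 2 ^ N := Real.rpow_le_rpow (by linarith) (by linarith) hN
          _ ≤ 2 ^ N * (1 + t ^ N) :=
            le_mul_of_one_le_right (by positivity) (by linarith [Real.rpow_nonneg ht.le N])
      · calc (1 + t) ^ N ≤ (2 * t) ^ N := Real.rpow_le_rpow (by linarith) (by linarith) hN
          _ = 2 ^ N * t ^ N := Real.mul_rpow (by norm_num) ht.le
          _ ≤ 2 ^ N * (1 + t ^ N) := by gcongr; linarith
    have h4 : t ^ (a + N - 1) = t ^ N * t ^ (a - 1) := by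
      rw [← Real.rpow_add ht]; ring_nf
    simp only [Pi.add_apply]
    rw [h4]
    calc (1 + t) ^ N * (t ^ (a - 1) * Real.exp (-t))
        ≤ 2 ^ N * (1 + t ^ N) * (t ^ (a - 1) * Real.exp (-t)) := by gcongr
      _ = _ := by ring

lemma PolyBounded.integrable {n : ℕ} {a : ℝ} (ha : 0 < a) {H : (Fin n → ℝ) → ℝ}
    (hH : PolyBounded H) : Integrable (fun x => H x * gammaProd n a x) (orthant n) := by
  obtain ⟨mH, C, N, hC, hN, hH⟩ := hH
  have h := Integrable.fintype_prod (ι := Fin n) (fun _ => integrableOn_one_add_rpow_gamma ha hN)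
  refine Integrable.mono' (h.const_mul C)
    (mH.mul (measurable_gammaProd n a)).aestronglyMeasurable ?_
  filter_upwards [ae_orthant_pos n] with x hx
  rw [Finset.prod_mul_distrib, Real.finsetProd_rpow _ _ fun i _ => by linarith [hx i], norm_mul,
    ← mul_assoc, Real.norm_eq_abs, Real.norm_of_nonneg (gammaProd_pos a hx).le]
  exact mul_le_mul_of_nonneg_right (hH x hx) (gammaProd_pos a hx).le

/-! ### The regularised interaction and Aomoto's recursion -/

/-- The regularised interaction `∏_{i ≠ j} ((x_i - x_j)² + ε) ^ (θ / 2)`. -/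
def interaction (n : ℕ) (θ ε : ℝ) (x : Fin n → ℝ) : ℝ :=
  ∏ p ∈ (Finset.univ : Finset (Fin n)).offDiag, ((x p.1 - x p.2) ^ 2 + ε) ^ (θ / 2)

lemma continuous_interaction (n : ℕ) {θ : ℝ} (hθ : 0 ≤ θ) (ε : ℝ) :
    Continuous (interaction n θ ε) := by
  unfold interaction
  refine continuous_finsetProd _ fun p _ => Continuous.rpow_const (by fun_prop) fun x => ?_
  right; positivity

lemma interaction_nonneg (n : ℕ) (θ : ℝ) {ε : ℝ} (hε : 0 ≤ ε) (x : Fin n → ℝ) :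
    0 ≤ interaction n θ ε x :=
  Finset.prod_nonneg fun _ _ => by positivity

lemma interaction_mono (n : ℕ) {θ ε δ : ℝ} (hθ : 0 ≤ θ) (hε : 0 ≤ ε) (h : ε ≤ δ)
    (x : Fin n → ℝ) : interaction n θ ε x ≤ interaction n θ δ x :=
  Finset.prod_le_prod (fun _ _ => by positivity) fun _ _ =>
    Real.rpow_le_rpow (by positivity) (by linarith) (by positivity)

lemma PolyBounded.interaction {n : ℕ} {θ ε : ℝ} (hθ : 0 ≤ θ) (hε : 0 ≤ ε) (hε1 : ε ≤ 1) :
    PolyBounded (interaction n θ ε) := by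
  refine ⟨(continuous_interaction n hθ ε).measurable, 1,
    4 * (θ / 2) * (Finset.univ : Finset (Fin n)).offDiag.card, by norm_num, by positivity,
    fun x hx => ?_⟩
  set P := ∏ i, (1 + x i) with hPdef
  have hP : 1 ≤ P := one_le_prod_one_add hx
  rw [abs_of_nonneg (interaction_nonneg n θ hε x), one_mul, Real.rpow_mul (by linarith),
    Real.rpow_natCast, Real.rpow_mul (by linarith), ← Finset.prod_const]
  -- Factor by factor: `(x - y) ^ 2 + ε ≤ ((1 + x) * (1 + y)) ^ 2 ≤ P ^ 4`, the first inequality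
  -- using `ε ≤ 1`. This is the origin of the `4` in the exponent.
  refine Finset.prod_le_prod (fun _ _ => by positivity) fun p _ => ?_
  refine Real.rpow_le_rpow (by positivity) ?_ (by positivity)
  have h1 := one_add_le_prod hx p.1
  have h2 := one_add_le_prod hx p.2
  have p1 := hx p.1
  have p2 := hx p.2
  have h3 : (x p.1 - x p.2) ^ 2 + ε ≤ ((1 + x p.1) * (1 + x p.2)) ^ 2 := by
    have : 0 < x p.1 * x p.2 := mul_pos p1 p2
    nlinarith
  have h4 : (1 + x p.1) * (1 + x p.2) ≤ P * P :=
    mul_le_mul h1 h2 (by linarith) (by linarith)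
  have h5 : ((1 + x p.1) * (1 + x p.2)) ^ 2 ≤ (P * P) ^ 2 :=
    pow_le_pow_left₀ (by positivity) h4 2
  have h6 : P ^ (4 : ℝ) = (P * P) ^ 2 := by
    rw [show (4 : ℝ) = ((4 : ℕ) : ℝ) by norm_num, Real.rpow_natCast]; ring
  rw [h6]
  exact h3.trans h5

lemma hasDerivAt_update_apply {n : ℕ} (x : Fin n → ℝ) (i j : Fin n) (t : ℝ) :
    HasDerivAt (fun t => Function.update x i t j) (if j = i then 1 else 0) t := by
  by_cases h : j = i
  · subst h
    simp only [Function.update_self, if_true]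
    exact hasDerivAt_id' t
  · simpa [h] using hasDerivAt_const t (x j)

/-- With `ε > 0` every factor is positive, so the interaction is the exponential of a smooth sum of
logarithms, even where particles coincide. -/
lemma hasDerivAt_interaction {n : ℕ} (θ : ℝ) {ε : ℝ} (hε : 0 < ε) (x : Fin n → ℝ) (i : Fin n) :
    HasDerivAt (fun t => interaction n θ ε (Function.update x i t))
      (interaction n θ ε x * ∑ p ∈ (Finset.univ : Finset (Fin n)).offDiag,
        θ * ((x p.1 - x p.2) / ((x p.1 - x p.2) ^ 2 + ε))
          * ((if p.1 = i then 1 else 0) - if p.2 = i then 1 else 0)) (x i) := by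
  have he : ∀ y : Fin n → ℝ, interaction n θ ε y
      = Real.exp (∑ p ∈ (Finset.univ : Finset (Fin n)).offDiag,
          θ / 2 * Real.log ((y p.1 - y p.2) ^ 2 + ε)) := by
    intro y
    rw [Real.exp_sum]
    refine Finset.prod_congr rfl fun p _ => ?_
    rw [Real.rpow_def_of_pos (by positivity), mul_comm]
  simp only [he]
  have key : HasDerivAt (fun t => ∑ p ∈ (Finset.univ : Finset (Fin n)).offDiag,
      θ / 2 * Real.log ((Function.update x i t p.1 - Function.update x i t p.2) ^ 2 + ε))
      (∑ p ∈ (Finset.univ : Finset (Fin n)).offDiag,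
        θ * ((x p.1 - x p.2) / ((x p.1 - x p.2) ^ 2 + ε))
          * ((if p.1 = i then 1 else 0) - if p.2 = i then 1 else 0)) (x i) := by
    refine HasDerivAt.fun_sum fun p _ => ?_
    have h1 := ((hasDerivAt_update_apply x i p.1 (x i)).sub
      (hasDerivAt_update_apply x i p.2 (x i))).pow 2
    have h2 := ((h1.add_const ε).log (by
      simp only [Pi.pow_apply, Pi.sub_apply]; positivity)).const_mul (θ / 2)
    refine h2.congr_deriv ?_
    simp only [Pi.pow_apply, Pi.sub_apply, Function.update_eq_self]
    push_cast
    ring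
  have := key.exp
  simp only [Function.update_eq_self] at this
  exact this

lemma sum_mul_sum_offDiag_ite {n : ℕ} (u : Fin n → ℝ) (g : Fin n × Fin n → ℝ) :
    ∑ i, u i * ∑ p ∈ (Finset.univ : Finset (Fin n)).offDiag,
        g p * ((if p.1 = i then 1 else 0) - if p.2 = i then 1 else 0)
      = ∑ p ∈ (Finset.univ : Finset (Fin n)).offDiag, g p * (u p.1 - u p.2) := by
  simp only [Finset.mul_sum]
  rw [Finset.sum_comm]
  refine Finset.sum_congr rfl fun p _ => ?_
  have : ∀ i, u i * (g p * ((if p.1 = i then 1 else 0) - if p.2 = i then 1 else 0))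
      = g p * ((if p.1 = i then u i else 0) - if p.2 = i then u i else 0) := by
    intro i; split_ifs <;> ring
  simp only [this, ← Finset.mul_sum, Finset.sum_sub_distrib, Finset.sum_ite_eq, Finset.mem_univ,
    if_true]

/-- Integrate by parts in each coordinate `i` with test function `e_k` of the other variables times
the interaction, then sum over `i`. The regularisation keeps the derivative of the interaction
polynomially bounded for every `θ ≥ 0`. -/
lemma integral_esymm_interaction_regularised {n : ℕ} {a θ ε : ℝ} (ha : 0 < a) (hθ : 0 ≤ θ)
    (hε : 0 < ε) (hε1 : ε ≤ 1) (k : ℕ) :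
    ∫ x, ((a * ((n : ℝ) - k) * esymmOn Finset.univ k x
          - ((k : ℝ) + 1) * esymmOn Finset.univ (k + 1) x) * interaction n θ ε x
        + θ * ∑ p ∈ (Finset.univ : Finset (Fin n)).offDiag,
          esymmOn ((Finset.univ.erase p.1).erase p.2) k x
            * ((x p.1 - x p.2) ^ 2 / ((x p.1 - x p.2) ^ 2 + ε) * interaction n θ ε x))
        * gammaProd n a x ∂orthant n = 0 := by
  set S : Fin n → (Fin n → ℝ) → ℝ := fun i x =>
    ∑ p ∈ (Finset.univ : Finset (Fin n)).offDiag,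
        θ * ((x p.1 - x p.2) / ((x p.1 - x p.2) ^ 2 + ε))
          * ((if p.1 = i then 1 else 0) - if p.2 = i then 1 else 0) with hS
  set H : Fin n → (Fin n → ℝ) → ℝ := fun i x =>
    esymmOn (Finset.univ.erase i) k x * interaction n θ ε x with hH
  set H' : Fin n → (Fin n → ℝ) → ℝ := fun i x =>
    esymmOn (Finset.univ.erase i) k x * (interaction n θ ε x * S i x) with hH'
  have hSb : ∀ i, PolyBounded (S i) := by
    intro i
    refine PolyBounded.sum _ fun p _ => PolyBounded.mul (PolyBounded.mul (.const _) ?_) (.const _)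
    refine PolyBounded.mono (((PolyBounded.coord p.1).sub (.coord p.2)).mul (.const ε⁻¹))
      (by fun_prop) fun x _ => ?_
    rw [abs_div, abs_mul, div_eq_mul_inv]
    refine mul_le_mul_of_nonneg_left ?_ (abs_nonneg _)
    rw [abs_of_pos (by positivity), abs_of_pos (by positivity)]
    exact inv_anti₀ hε (by nlinarith [sq_nonneg (x p.1 - x p.2)])
  have hI := PolyBounded.interaction (n := n) hθ hε.le hε1
  have hHb : ∀ i, PolyBounded (H i) := fun i => (PolyBounded.esymmOn _ _).mul hI
  have hHb' : ∀ i, PolyBounded (H' i) := fun i =>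
    (PolyBounded.esymmOn _ _).mul (hI.mul (hSb i))
  have hint : ∀ i, Integrable
      (fun x => ((a - x i) * H i x + x i * H' i x) * gammaProd n a x) (orthant n) := fun i =>
    PolyBounded.integrable ha (((((PolyBounded.const a).sub (.coord i)).mul (hHb i))).add
      ((PolyBounded.coord i).mul (hHb' i)))
  have hzero : ∀ i, ∫ x, ((a - x i) * H i x + x i * H' i x) * gammaProd n a x ∂orthant n = 0 := by
    intro i
    refine integral_gammaProd_byParts ha i (fun x => ?_)
      (PolyBounded.integrable ha ((PolyBounded.coord i).mul (hHb i))) (hint i)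
    have h1 : ∀ t, H i (Function.update x i t)
        = esymmOn (Finset.univ.erase i) k x * interaction n θ ε (Function.update x i t) := by
      intro t
      simp only [hH]
      rw [esymmOn_update _ _ _ (Finset.notMem_erase i _)]
    simp only [h1]
    exact (hasDerivAt_interaction θ hε x i).const_mul _
  rw [← Finset.sum_eq_zero fun i (_ : i ∈ Finset.univ) => hzero i,
    ← integral_finsetSum _ fun i _ => hint i]
  congr 1
  funext x
  rw [← Finset.sum_mul]
  congr 1
  have e1 : ∑ i, ((a - x i) * H i x + x i * H' i x)
      = (a * ∑ i, esymmOn (Finset.univ.erase i) k x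
          - ∑ i, x i * esymmOn (Finset.univ.erase i) k x) * interaction n θ ε x
        + interaction n θ ε x * ∑ i, (x i * esymmOn (Finset.univ.erase i) k x) * S i x := by
    simp only [hH, hH', Finset.mul_sum, Finset.sum_mul, ← Finset.sum_sub_distrib,
      ← Finset.sum_add_distrib]
    refine Finset.sum_congr rfl fun i _ => ?_
    ring
  rw [e1, sum_esymmOn_erase, sum_mul_esymmOn_erase, Finset.card_univ, Fintype.card_fin,
    sum_mul_sum_offDiag_ite (fun i => x i * esymmOn (Finset.univ.erase i) k x), mul_assoc a]
  congr 1
  rw [Finset.mul_sum, Finset.mul_sum]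
  refine Finset.sum_congr rfl fun p hp => ?_
  rw [mul_esymmOn_erase_sub _ (Finset.mem_univ _) (Finset.mem_univ _) (Finset.mem_offDiag.1 hp).2.2]
  ring

lemma interaction_eq_zero {n : ℕ} {θ : ℝ} (hθ : 0 < θ) {x : Fin n → ℝ} {i j : Fin n} (hij : i ≠ j)
    (h : x i = x j) : interaction n θ 0 x = 0 := by
  refine Finset.prod_eq_zero (i := (i, j)) (by simpa using hij) ?_
  simp only [h, sub_self, add_zero]
  rw [zero_pow two_ne_zero, Real.zero_rpow (by positivity)]

lemma tendsto_interaction {n : ℕ} {θ : ℝ} (hθ : 0 ≤ θ) (x : Fin n → ℝ) :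
    Tendsto (fun ε => interaction n θ ε x) (𝓝[>] 0) (𝓝 (interaction n θ 0 x)) := by
  have : Continuous fun ε => interaction n θ ε x := by
    unfold interaction
    refine continuous_finsetProd _ fun p _ => Continuous.rpow_const (by fun_prop) fun x => ?_
    right; positivity
  exact (this.tendsto 0).mono_left nhdsWithin_le_nhds

/-- Aomoto's recursion for the averages of the elementary symmetric polynomials. -/
lemma integral_esymm_succ_interaction {n : ℕ} {a θ : ℝ} (ha : 0 < a) (hθ : 0 < θ) (k : ℕ) :
    ((k : ℝ) + 1) * ∫ x, esymmOn Finset.univ (k + 1) x * interaction n θ 0 x * gammaProd n a x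
        ∂orthant n
      = ((n : ℝ) - k) * (a + θ * ((n : ℝ) - 1 - k))
        * ∫ x, esymmOn Finset.univ k x * interaction n θ 0 x * gammaProd n a x ∂orthant n := by
  set F : ℝ → (Fin n → ℝ) → ℝ := fun ε x =>
    ((a * ((n : ℝ) - k) * esymmOn Finset.univ k x
          - ((k : ℝ) + 1) * esymmOn Finset.univ (k + 1) x) * interaction n θ ε x
        + θ * ∑ p ∈ (Finset.univ : Finset (Fin n)).offDiag,
          esymmOn ((Finset.univ.erase p.1).erase p.2) k x
            * ((x p.1 - x p.2) ^ 2 / ((x p.1 - x p.2) ^ 2 + ε) * interaction n θ ε x)) with hF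
  set F₀ : (Fin n → ℝ) → ℝ := fun x =>
    ((a * ((n : ℝ) - k) * esymmOn Finset.univ k x
          - ((k : ℝ) + 1) * esymmOn Finset.univ (k + 1) x) * interaction n θ 0 x
        + θ * ∑ p ∈ (Finset.univ : Finset (Fin n)).offDiag,
          esymmOn ((Finset.univ.erase p.1).erase p.2) k x * interaction n θ 0 x) with hF₀
  -- Dominating function for `ε → 0`: the interaction increases with `ε`, so its value at `ε = 1`
  -- serves for all `ε ≤ 1`, and the quotients are at most `1`.
  set B : (Fin n → ℝ) → ℝ := fun x =>
    (|a * ((n : ℝ) - k)| * esymmOn Finset.univ k x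
          + ((k : ℝ) + 1) * esymmOn Finset.univ (k + 1) x) * interaction n θ 1 x
        + θ * ∑ p ∈ (Finset.univ : Finset (Fin n)).offDiag,
          esymmOn ((Finset.univ.erase p.1).erase p.2) k x * interaction n θ 1 x with hB
  have hε : ∀ᶠ ε : ℝ in 𝓝[>] 0, 0 < ε ∧ ε ≤ 1 :=
    mem_of_superset (Ioc_mem_nhdsGT one_pos) fun _ h => h
  have hBi : Integrable (fun x => B x * gammaProd n a x) (orthant n) := by
    have hI := PolyBounded.interaction (n := n) hθ.le zero_le_one le_rfl
    refine PolyBounded.integrable ha (PolyBounded.add (PolyBounded.mul (PolyBounded.add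
      ((PolyBounded.const _).mul (.esymmOn _ _)) ((PolyBounded.const _).mul (.esymmOn _ _))) hI)
      ((PolyBounded.const _).mul (PolyBounded.sum _ fun p _ => (PolyBounded.esymmOn _ _).mul hI)))
  have hlim : Tendsto (fun ε => ∫ x, F ε x * gammaProd n a x ∂orthant n) (𝓝[>] 0)
      (𝓝 (∫ x, F₀ x * gammaProd n a x ∂orthant n)) := by
    refine tendsto_integral_filter_of_dominated_convergence _ ?_ ?_ hBi ?_
    · refine Eventually.of_forall fun ε => Measurable.aestronglyMeasurable ?_
      refine Measurable.mul ?_ (measurable_gammaProd n a)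
      have h1 : ∀ s k, Measurable (esymmOn (ι := Fin n) s k) := fun s k =>
        (continuous_esymmOn s k).measurable
      have h2 := (continuous_interaction n hθ.le ε).measurable
      simp only [hF]
      refine Measurable.add (Measurable.mul (Measurable.sub ((h1 _ _).const_mul _)
        ((h1 _ _).const_mul _)) h2) (Measurable.const_mul (Finset.measurable_fun_sum _ fun p _ =>
          (h1 _ _).mul (Measurable.mul (by fun_prop) h2)) _)
    · filter_upwards [hε] with ε hε
      filter_upwards [ae_orthant_pos n] with x hx
      rw [norm_mul, Real.norm_of_nonneg (gammaProd_pos a hx).le]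
      refine mul_le_mul_of_nonneg_right ?_ (gammaProd_pos a hx).le
      have hes : ∀ s k, 0 ≤ esymmOn s k x := fun s k => esymmOn_nonneg s k fun i => (hx i).le
      have hi0 := interaction_nonneg n θ hε.1.le x
      have hi1 := interaction_mono n hθ.le hε.1.le hε.2 x
      refine (norm_add_le _ _).trans (add_le_add ?_ ?_)
      · rw [norm_mul, Real.norm_of_nonneg hi0]
        refine mul_le_mul ((norm_sub_le _ _).trans (add_le_add ?_ ?_)) hi1 hi0
          (add_nonneg (mul_nonneg (abs_nonneg _) (hes _ _)) (mul_nonneg (by positivity) (hes _ _)))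
        · rw [norm_mul, Real.norm_of_nonneg (hes _ _), Real.norm_eq_abs]
        · rw [norm_mul, Real.norm_of_nonneg (hes _ _), Real.norm_of_nonneg (by positivity)]
      · rw [norm_mul, Real.norm_of_nonneg hθ.le]
        refine mul_le_mul_of_nonneg_left ((norm_sum_le _ _).trans
          (Finset.sum_le_sum fun p _ => ?_)) hθ.le
        have hq : (x p.1 - x p.2) ^ 2 / ((x p.1 - x p.2) ^ 2 + ε) ≤ 1 :=
          div_le_one_of_le₀ (by linarith) (by nlinarith [sq_nonneg (x p.1 - x p.2)])
        have hq0 : 0 ≤ (x p.1 - x p.2) ^ 2 / ((x p.1 - x p.2) ^ 2 + ε) :=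
          div_nonneg (sq_nonneg _) (by nlinarith [sq_nonneg (x p.1 - x p.2)])
        rw [norm_mul, Real.norm_of_nonneg (hes _ _), Real.norm_of_nonneg (mul_nonneg hq0 hi0)]
        refine mul_le_mul_of_nonneg_left ?_ (hes _ _)
        exact (mul_le_of_le_one_left hi0 hq).trans hi1
    · refine Eventually.of_forall fun x => Tendsto.mul_const _ ?_
      have hv := tendsto_interaction hθ.le x
      refine (hv.const_mul _).add (Tendsto.const_mul _ (tendsto_finsetSum _ fun p hp =>
        Tendsto.const_mul _ ?_))
      -- At a coincidence the quotient is `0` and does not tend to `1`, but the limiting interaction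
      -- vanishes there because `θ > 0`.
      by_cases hd : x p.1 = x p.2
      · rw [interaction_eq_zero hθ (Finset.mem_offDiag.1 hp).2.2 hd]
        simp [hd]
      · have hd' : (x p.1 - x p.2) ^ 2 + 0 ≠ 0 := by
          rw [add_zero]; exact pow_ne_zero _ (sub_ne_zero.2 hd)
        have hc : Tendsto (fun ε : ℝ => (x p.1 - x p.2) ^ 2 / ((x p.1 - x p.2) ^ 2 + ε)) (𝓝[>] 0)
            (𝓝 ((x p.1 - x p.2) ^ 2 / ((x p.1 - x p.2) ^ 2 + 0))) := by
          refine Tendsto.mono_left ?_ nhdsWithin_le_nhds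
          exact tendsto_const_nhds.div (tendsto_const_nhds.add tendsto_id) hd'
        have := hc.mul hv
        rwa [add_zero, div_self (by simpa using hd'), one_mul] at this
  have hlim0 : Tendsto (fun ε => ∫ x, F ε x * gammaProd n a x ∂orthant n) (𝓝[>] 0) (𝓝 0) := by
    refine tendsto_const_nhds.congr' ?_
    filter_upwards [hε] with ε hε
    exact (integral_esymm_interaction_regularised ha hθ.le hε.1 hε.2 k).symm
  have h0 := tendsto_nhds_unique hlim hlim0
  have hI := PolyBounded.interaction (n := n) hθ.le le_rfl zero_le_one
  have hi : ∀ k, Integrable (fun x => esymmOn Finset.univ k x * interaction n θ 0 x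
      * gammaProd n a x) (orthant n) := fun k =>
    PolyBounded.integrable ha ((PolyBounded.esymmOn _ _).mul hI)
  have e : ∀ x, F₀ x * gammaProd n a x
      = ((n : ℝ) - k) * (a + θ * ((n : ℝ) - 1 - k))
          * (esymmOn Finset.univ k x * interaction n θ 0 x * gammaProd n a x)
        - ((k : ℝ) + 1) * (esymmOn Finset.univ (k + 1) x * interaction n θ 0 x
          * gammaProd n a x) := by
    intro x
    simp only [hF₀]
    rw [← Finset.sum_mul, sum_offDiag_esymmOn_erase, Finset.card_univ, Fintype.card_fin]
    ring
  simp only [e] at h0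
  rw [integral_sub ((hi _).const_mul _) ((hi _).const_mul _), integral_const_mul,
    integral_const_mul] at h0
  linarith

/-! ### The Laguerre integral: unit shift, positivity, log-convexity -/

/-- The Laguerre–Selberg integral with interaction exponent `2θ`. -/
def laguerreIntegral (n : ℕ) (θ a : ℝ) : ℝ :=
  ∫ x, interaction n θ 0 x * gammaProd n a x ∂orthant n

lemma integrable_interaction_gammaProd (n : ℕ) {θ a : ℝ} (hθ : 0 ≤ θ) (ha : 0 < a) :
    Integrable (fun x => interaction n θ 0 x * gammaProd n a x) (orthant n) :=
  (PolyBounded.interaction hθ le_rfl zero_le_one).integrable ha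

lemma gammaProd_eq_exp {n : ℕ} (a : ℝ) {x : Fin n → ℝ} (hx : ∀ i, 0 < x i) :
    gammaProd n a x = Real.exp ((a - 1) * ∑ i, Real.log (x i) - ∑ i, x i) := by
  rw [Finset.mul_sum, ← Finset.sum_sub_distrib, Real.exp_sum]
  refine Finset.prod_congr rfl fun i _ => ?_
  rw [Real.rpow_def_of_pos (hx i), ← Real.exp_add]
  ring_nf

lemma gammaProd_add_one {n : ℕ} (a : ℝ) {x : Fin n → ℝ} (hx : ∀ i, 0 < x i) :
    gammaProd n (a + 1) x = (∏ i, x i) * gammaProd n a x := by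
  unfold gammaProd
  rw [← Finset.prod_mul_distrib]
  refine Finset.prod_congr rfl fun i _ => ?_
  have : a + 1 - 1 = 1 + (a - 1) := by ring
  rw [this, Real.rpow_add (hx i), Real.rpow_one, mul_assoc]

/-- Aomoto's recursion is run from `e_0 = 1` up to `e_n = ∏ x_i`; multiplying the density by the
latter raises `a` by one. -/
lemma laguerreIntegral_add_one (n : ℕ) {θ a : ℝ} (hθ : 0 < θ) (ha : 0 < a) :
    laguerreIntegral n θ (a + 1)
      = (∏ j ∈ Finset.range n, (a + j * θ)) * laguerreIntegral n θ a := by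
  set I : ℕ → ℝ := fun k =>
    ∫ x, esymmOn Finset.univ k x * interaction n θ 0 x * gammaProd n a x ∂orthant n with hI
  have hrec : ∀ k ≤ n, I k
      = n.choose k * (∏ j ∈ Finset.range k, (a + θ * ((n : ℝ) - 1 - j))) * I 0 := by
    intro k
    induction k with
    | zero => simp
    | succ k ih =>
      intro hk
      have h1 := integral_esymm_succ_interaction (n := n) ha hθ k
      change ((k : ℝ) + 1) * I (k + 1) = _ * I k at h1
      rw [ih (by omega)] at h1
      have h2 : (n.choose (k + 1) : ℝ) * (k + 1) = n.choose k * ((n : ℝ) - k) := by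
        rw [← Nat.cast_sub (by omega)]
        exact_mod_cast Nat.choose_succ_right_eq n k
      rw [Finset.prod_range_succ]
      have h3 : (k : ℝ) + 1 ≠ 0 := by positivity
      apply mul_left_cancel₀ h3
      rw [h1]
      linear_combination (-(∏ j ∈ Finset.range k, (a + θ * ((n : ℝ) - 1 - j)))
        * (a + θ * ((n : ℝ) - 1 - k)) * I 0) * h2
  have hn := hrec n le_rfl
  have h0 : I 0 = laguerreIntegral n θ a := by
    simp only [hI, esymmOn_zero, one_mul, laguerreIntegral]
  have h1 : laguerreIntegral n θ (a + 1) = I n := by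
    refine integral_congr_ae ?_
    filter_upwards [ae_orthant_pos n] with x hx
    have := esymmOn_card (Finset.univ : Finset (Fin n)) x
    rw [Finset.card_univ, Fintype.card_fin] at this
    rw [gammaProd_add_one a hx, this]
    ring
  rw [h1, hn, h0, Nat.choose_self, Nat.cast_one, one_mul, ← Finset.prod_range_reflect]
  congr 1
  refine Finset.prod_congr rfl fun j hj => ?_
  have hj := Finset.mem_range.1 hj
  rw [Nat.cast_sub (by omega), Nat.cast_sub (by omega)]
  push_cast
  ring

lemma interaction_pos {n : ℕ} (θ : ℝ) {x : Fin n → ℝ} (hx : Function.Injective x) :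
    0 < interaction n θ 0 x := by
  refine Finset.prod_pos fun p hp => Real.rpow_pos_of_pos ?_ _
  have : x p.1 - x p.2 ≠ 0 := sub_ne_zero.2 (hx.ne (Finset.mem_offDiag.1 hp).2.2)
  positivity

lemma isOpen_configurations (n : ℕ) : IsOpen (configurations n) := by
  have : configurations n = (⋂ i, {x : Fin n → ℝ | 0 < x i})
      ∩ ⋂ p ∈ (Finset.univ : Finset (Fin n)).offDiag, {x : Fin n → ℝ | x p.1 ≠ x p.2} := by
    ext x
    simp only [configurations, Set.mem_ofPred_eq, Set.mem_inter_iff, Set.mem_iInter,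
      Finset.mem_offDiag, Finset.mem_univ, true_and]
    refine and_congr_right fun _ => ⟨fun h p hp => h.ne hp, fun h i j hij => ?_⟩
    by_contra hne
    exact h (i, j) hne hij
  rw [this]
  refine (isOpen_iInter_of_finite fun i => isOpen_lt continuous_const (continuous_apply i)).inter
    (isOpen_biInter_finset fun p _ => isOpen_ne_fun (continuous_apply _) (continuous_apply _))

lemma configurations_nonempty (n : ℕ) : (configurations n).Nonempty :=
  ⟨fun i => (i : ℝ) + 1, fun i => by positivity, fun i j h => by
    simpa [Fin.ext_iff] using h⟩

lemma laguerreIntegral_pos (n : ℕ) {θ a : ℝ} (hθ : 0 ≤ θ) (ha : 0 < a) :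
    0 < laguerreIntegral n θ a := by
  rw [laguerreIntegral, integral_pos_iff_support_of_nonneg_ae _
    (integrable_interaction_gammaProd n hθ ha)]
  · refine lt_of_lt_of_le ?_ (measure_mono (s := configurations n) fun x hx =>
      (mul_pos (interaction_pos θ hx.2) (gammaProd_pos a hx.1)).ne')
    rw [orthant_eq_restrict, Measure.restrict_eq_self]
    · exact (isOpen_configurations n).measure_pos _ (configurations_nonempty n)
    · exact fun x hx i _ => hx.1 i
  · filter_upwards [ae_orthant_pos n] with x hx
    exact mul_nonneg (interaction_nonneg n θ le_rfl x) (gammaProd_pos a hx).le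

/-- The density is log-affine in its parameter, so this is weighted AM–GM after normalising by `A`
and `B`. With these chosen as the two integrals, integration gives Hölder's inequality. -/
lemma gammaProd_convexCombination_le {n : ℕ} {a b u v A B : ℝ} (hu : 0 ≤ u) (hv : 0 ≤ v)
    (huv : u + v = 1) (hA : 0 < A) (hB : 0 < B) {x : Fin n → ℝ} (hx : ∀ i, 0 < x i) :
    gammaProd n (u * a + v * b) x
      ≤ A ^ u * B ^ v * (u / A * gammaProd n a x + v / B * gammaProd n b x) := by
  have ga := gammaProd_pos a hx
  have gb := gammaProd_pos b hx
  have h1 : gammaProd n (u * a + v * b) x = gammaProd n a x ^ u * gammaProd n b x ^ v := by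
    rw [gammaProd_eq_exp _ hx, gammaProd_eq_exp a hx, gammaProd_eq_exp b hx, ← Real.exp_mul,
      ← Real.exp_mul, ← Real.exp_add]
    congr 1
    linear_combination (∑ i, Real.log (x i) + ∑ i, x i) * huv
  have h2 := Real.geom_mean_le_arith_mean2_weighted hu hv (div_pos ga hA).le (div_pos gb hB).le huv
  rw [Real.div_rpow ga.le hA.le, Real.div_rpow gb.le hB.le] at h2
  have hAu := Real.rpow_pos_of_pos hA u
  have hBv := Real.rpow_pos_of_pos hB v
  rw [h1]
  calc gammaProd n a x ^ u * gammaProd n b x ^ v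
      = A ^ u * B ^ v * (gammaProd n a x ^ u / A ^ u * (gammaProd n b x ^ v / B ^ v)) := by
        field_simp
    _ ≤ A ^ u * B ^ v * (u * (gammaProd n a x / A) + v * (gammaProd n b x / B)) :=
        mul_le_mul_of_nonneg_left h2 (by positivity)
    _ = _ := by ring

lemma convexOn_log_laguerreIntegral (n : ℕ) {θ : ℝ} (hθ : 0 ≤ θ) :
    ConvexOn ℝ (Set.Ioi 0) fun a => Real.log (laguerreIntegral n θ a) := by
  refine ⟨convex_Ioi 0, fun a ha b hb u v hu hv huv => ?_⟩
  have hc : 0 < u * a + v * b := (convex_Ioi (0 : ℝ)) ha hb hu hv huv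
  have pa := laguerreIntegral_pos n hθ (a := a) ha
  have pb := laguerreIntegral_pos n hθ (a := b) hb
  have pc := laguerreIntegral_pos n hθ hc
  have ia := integrable_interaction_gammaProd n hθ (a := a) ha
  have ib := integrable_interaction_gammaProd n hθ (a := b) hb
  set A := laguerreIntegral n θ a with hA
  set B := laguerreIntegral n θ b with hB
  have key : laguerreIntegral n θ (u * a + v * b) ≤ A ^ u * B ^ v := by
    calc laguerreIntegral n θ (u * a + v * b)
        ≤ ∫ x, A ^ u * B ^ v * (u / A * (interaction n θ 0 x * gammaProd n a x)
            + v / B * (interaction n θ 0 x * gammaProd n b x)) ∂orthant n := by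
          refine integral_mono_ae (integrable_interaction_gammaProd n hθ hc)
            (((ia.const_mul _).add (ib.const_mul _)).const_mul _) ?_
          filter_upwards [ae_orthant_pos n] with x hx
          have := mul_le_mul_of_nonneg_left
            (gammaProd_convexCombination_le (a := a) (b := b) hu hv huv pa pb hx)
            (interaction_nonneg n θ le_rfl x)
          refine this.trans (le_of_eq ?_)
          ring
      _ = A ^ u * B ^ v * (u / A * A + v / B * B) := by
          rw [integral_const_mul, integral_add (ia.const_mul _) (ib.const_mul _),
            integral_const_mul, integral_const_mul, hA, hB, laguerreIntegral, laguerreIntegral]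
      _ = A ^ u * B ^ v := by
          rw [div_mul_cancel₀ _ pa.ne', div_mul_cancel₀ _ pb.ne', huv, mul_one]
  calc Real.log (laguerreIntegral n θ (u * a + v * b)) ≤ Real.log (A ^ u * B ^ v) :=
        Real.log_le_log pc key
    _ = u * Real.log A + v * Real.log B := by
        rw [Real.log_mul (Real.rpow_pos_of_pos pa u).ne' (Real.rpow_pos_of_pos pb v).ne',
          Real.log_rpow pa, Real.log_rpow pb]

/-! ### Primitives of the logarithm and Riemann sums -/

/-- The primitive `x ln x - x` of the logarithm. -/
def logPrim (x : ℝ) : ℝ := x * Real.log x - x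

/-- The second primitive `x² / 2 ln x - 3 x² / 4` of the logarithm. -/
def logPrimTwo (x : ℝ) : ℝ := x ^ 2 / 2 * Real.log x - 3 / 4 * x ^ 2

lemma hasDerivAt_logPrim {x : ℝ} (hx : 0 < x) : HasDerivAt logPrim (Real.log x) x := by
  have h := ((hasDerivAt_id' x).mul (Real.hasDerivAt_log hx.ne')).sub (hasDerivAt_id' x)
  refine h.congr_deriv ?_
  field_simp
  ring

lemma hasDerivAt_logPrimTwo {x : ℝ} (hx : 0 < x) : HasDerivAt logPrimTwo (logPrim x) x := by
  have h := ((((hasDerivAt_id' x).pow 2).div_const 2).mul (Real.hasDerivAt_log hx.ne')).sub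
    (((hasDerivAt_id' x).pow 2).const_mul (3 / 4))
  refine h.congr_deriv ?_
  simp only [Pi.pow_apply, logPrim]
  field_simp
  ring

lemma sub_bounds_of_hasDerivAt_monotone {F f : ℝ → ℝ} {x y : ℝ} (hxy : x ≤ y)
    (hd : ∀ t ∈ Set.Icc x y, HasDerivAt F (f t) t) (hm : MonotoneOn f (Set.Icc x y)) :
    f x * (y - x) ≤ F y - F x ∧ F y - F x ≤ f y * (y - x) := by
  rcases hxy.eq_or_lt with rfl | h
  · simp
  obtain ⟨c, hc, hs⟩ := exists_hasDerivAt_eq_slope F f h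
    (fun t ht => (hd t ht).continuousAt.continuousWithinAt)
    (fun t ht => hd t (Set.Ioo_subset_Icc_self ht))
  have hc' := Set.Ioo_subset_Icc_self hc
  have hF : F y - F x = f c * (y - x) := by
    rw [hs, div_mul_cancel₀ _ (sub_pos.2 h).ne']
  rw [hF]
  exact ⟨mul_le_mul_of_nonneg_right (hm (Set.left_mem_Icc.2 hxy) hc' hc'.1) (by linarith),
    mul_le_mul_of_nonneg_right (hm hc' (Set.right_mem_Icc.2 hxy) hc'.2) (by linarith)⟩

/-- Integral approximation to `∑ j < n, ln (x + j θ)`. -/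
def driftApprox (n : ℕ) (θ x : ℝ) : ℝ := (logPrim (x + n * θ) - logPrim x) / θ

/-- Primitive of `driftApprox`, the leading order of the logarithm of the Laguerre integral. -/
def freeEnergyApprox (n : ℕ) (θ x : ℝ) : ℝ := (logPrimTwo (x + n * θ) - logPrimTwo x) / θ

lemma logPrim_step {θ x : ℝ} (hθ : 0 ≤ θ) (hx : 0 < x) :
    Real.log x * θ ≤ logPrim (x + θ) - logPrim x
      ∧ logPrim (x + θ) - logPrim x ≤ Real.log (x + θ) * θ := by
  have := sub_bounds_of_hasDerivAt_monotone (F := logPrim) (f := Real.log) (x := x) (y := x + θ)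
    (by linarith) (fun t ht => hasDerivAt_logPrim (hx.trans_le ht.1))
    (fun s hs t _ hst => Real.log_le_log (hx.trans_le hs.1) hst)
  simpa using this

/-- A left Riemann sum of an increasing function lies below the integral. -/
lemma sum_log_le_driftApprox (n : ℕ) {θ x : ℝ} (hθ : 0 < θ) (hx : 0 < x) :
    ∑ j ∈ Finset.range n, Real.log (x + j * θ) ≤ driftApprox n θ x := by
  rw [driftApprox, le_div_iff₀ hθ]
  induction n with
  | zero => simp
  | succ n ih =>
    have := (logPrim_step (x := x + n * θ) hθ.le (by positivity)).1
    rw [Finset.sum_range_succ, add_mul]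
    have e : x + ((n + 1 : ℕ) : ℝ) * θ = x + n * θ + θ := by push_cast; ring
    rw [e]
    linarith

/-- The right Riemann sum exceeds the left one by `ln (x + n θ) - ln x`, and `θ ≤ x` bounds this by
`ln (n + 1)`. -/
lemma driftApprox_le_sum_log (n : ℕ) {θ x : ℝ} (hθ : 0 < θ) (hx : θ ≤ x) :
    driftApprox n θ x ≤ ∑ j ∈ Finset.range n, Real.log (x + j * θ) + Real.log (n + 1) := by
  have hx0 : 0 < x := hθ.trans_le hx
  have h : driftApprox n θ x
      ≤ ∑ j ∈ Finset.range n, Real.log (x + j * θ) + (Real.log (x + n * θ) - Real.log x) := by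
    rw [driftApprox, div_le_iff₀ hθ]
    induction n with
    | zero => simp
    | succ n ih =>
      have := (logPrim_step (x := x + n * θ) hθ.le (by positivity)).2
      rw [Finset.sum_range_succ]
      have e : x + ((n + 1 : ℕ) : ℝ) * θ = x + n * θ + θ := by push_cast; ring
      rw [e]
      linarith
  have h2 : Real.log (x + n * θ) - Real.log x ≤ Real.log (n + 1) := by
    rw [sub_le_iff_le_add, ← Real.log_mul (by positivity) hx0.ne']
    refine Real.log_le_log (by positivity) ?_
    nlinarith [mul_le_mul_of_nonneg_left hx (Nat.cast_nonneg (α := ℝ) n)]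
  linarith

lemma hasDerivAt_freeEnergyApprox (n : ℕ) {θ x : ℝ} (hθ : 0 < θ) (hx : 0 < x) :
    HasDerivAt (freeEnergyApprox n θ) (driftApprox n θ x) x := by
  have h1 : HasDerivAt (fun x => logPrimTwo (x + n * θ)) (logPrim (x + n * θ)) x :=
    (hasDerivAt_logPrimTwo (x := x + n * θ) (by positivity)).comp_add_const x (n * θ)
  exact (h1.sub (hasDerivAt_logPrimTwo hx)).div_const θ

lemma monotoneOn_driftApprox (n : ℕ) {θ : ℝ} (hθ : 0 < θ) :
    MonotoneOn (driftApprox n θ) (Set.Ioi 0) := by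
  intro x hx y hy hxy
  have hx : 0 < x := hx
  refine div_le_div_of_nonneg_right ?_ hθ.le
  have hnθ : 0 ≤ n * θ := by positivity
  have hd : ∀ t ∈ Set.Icc x y, HasDerivAt (fun t => logPrim (t + n * θ) - logPrim t)
      (Real.log (t + n * θ) - Real.log t) t := fun t ht =>
    have ht0 : 0 < t := hx.trans_le ht.1
    ((hasDerivAt_logPrim (x := t + n * θ) (by linarith)).comp_add_const t (n * θ)).sub
      (hasDerivAt_logPrim ht0)
  refine monotoneOn_of_deriv_nonneg (convex_Icc x y)
    (fun t ht => (hd t ht).continuousAt.continuousWithinAt)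
    (fun t ht => (hd t (interior_subset ht)).differentiableAt.differentiableWithinAt)
    (fun t ht => ?_) (Set.left_mem_Icc.2 hxy) (Set.right_mem_Icc.2 hxy) hxy
  rw [(hd t (interior_subset ht)).deriv, sub_nonneg]
  exact Real.log_le_log (hx.trans_le (interior_subset ht).1) (by linarith)

/-- A function decreasing over steps of length at most one is antitone. -/
lemma antitoneOn_Ici_of_unit_steps {g : ℝ → ℝ} {x₀ : ℝ}
    (h : ∀ t, x₀ ≤ t → ∀ s, 0 < s → s ≤ 1 → g (t + s) ≤ g t) : AntitoneOn g (Set.Ici x₀) := by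
  intro x hx y _ hxy
  have hx : x₀ ≤ x := hx
  rcases hxy.eq_or_lt with rfl | hlt
  · exact le_rfl
  obtain ⟨N, hN⟩ := exists_nat_gt (y - x)
  have hN0 : (0 : ℝ) < N := (sub_pos.2 hlt).trans hN
  set s := (y - x) / N with hs
  have hs0 : 0 < s := div_pos (sub_pos.2 hlt) hN0
  have hs1 : s ≤ 1 := (div_le_one hN0).2 hN.le
  have key : ∀ k : ℕ, g (x + k * s) ≤ g x := by
    intro k
    induction k with
    | zero => simp
    | succ k ih =>
      have e : x + ((k + 1 : ℕ) : ℝ) * s = x + k * s + s := by push_cast; ring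
      rw [e]
      exact (h _ (by nlinarith [mul_nonneg (Nat.cast_nonneg (α := ℝ) k) hs0.le]) s hs0 hs1).trans ih
  have := key N
  rwa [hs, mul_div_cancel₀ _ hN0.ne', add_sub_cancel] at this

/-! ### Comparison of a convex function with its integral approximation -/

section convex

variable {n : ℕ} {θ : ℝ} {f : ℝ → ℝ}

lemma freeEnergyApprox_step (n : ℕ) {t s : ℝ} (hθ : 0 < θ) (ht : 0 < t) (hs : 0 ≤ s) :
    driftApprox n θ t * s ≤ freeEnergyApprox n θ (t + s) - freeEnergyApprox n θ t ∧
      freeEnergyApprox n θ (t + s) - freeEnergyApprox n θ t ≤ driftApprox n θ (t + s) * s := by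
  have := sub_bounds_of_hasDerivAt_monotone (F := freeEnergyApprox n θ) (f := driftApprox n θ)
    (x := t) (y := t + s) (by linarith)
    (fun r hr => hasDerivAt_freeEnergyApprox n hθ (ht.trans_le hr.1))
    ((monotoneOn_driftApprox n hθ).mono fun r hr => ht.trans_le hr.1)
  simpa using this

/-- On a step `s ≤ 1` the chord of `f` over `[t, t + 1]` bounds its growth by `s` times the sum of
logarithms at `t`, hence by `s * driftApprox n θ t`, which the approximation attains at least. -/
lemma antitoneOn_sub_freeEnergyApprox (hθ : 0 < θ) (hf : ConvexOn ℝ (Set.Ioi 0) f)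
    (hrec : ∀ t, 0 < t → f (t + 1) = f t + ∑ j ∈ Finset.range n, Real.log (t + j * θ)) :
    AntitoneOn (fun t => f t - freeEnergyApprox n θ t) (Set.Ici θ) := by
  refine antitoneOn_Ici_of_unit_steps fun t ht s hs hs1 => ?_
  have ht0 : 0 < t := hθ.trans_le ht
  have h1 := hf.2 (x := t) (y := t + 1) ht0 (by simp only [Set.mem_Ioi]; linarith)
    (sub_nonneg.2 hs1) hs.le (by ring)
  simp only [smul_eq_mul] at h1
  rw [show (1 - s) * t + s * (t + 1) = t + s by ring, hrec t ht0] at h1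
  have h2 := mul_le_mul_of_nonneg_left (sum_log_le_driftApprox n hθ ht0) hs.le
  have h3 := (freeEnergyApprox_step n hθ ht0 hs.le).1
  linarith

/-- The slope of `f` beyond `t + 2` is at least that over `[t + 1, t + 2]`, the sum of logarithms at
`t + 1`. The shift by two is what places this sum at a point `t + 1 ≥ t + s`, so that it dominates
the drift along the whole step up to `ln (n + 1)`. -/
lemma antitoneOn_freeEnergyApprox_sub (hθ : 0 < θ) (hf : ConvexOn ℝ (Set.Ioi 0) f)
    (hrec : ∀ t, 0 < t → f (t + 1) = f t + ∑ j ∈ Finset.range n, Real.log (t + j * θ)) :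
    AntitoneOn (fun t => freeEnergyApprox n θ t - f (t + 1 + 1) - t * Real.log (n + 1))
      (Set.Ici θ) := by
  refine antitoneOn_Ici_of_unit_steps fun t ht s hs hs1 => ?_
  have ht0 : 0 < t := hθ.trans_le ht
  have h1 := hf.slope_mono_adjacent (x := t + 1) (y := t + 1 + 1) (z := t + s + 1 + 1)
    (by simp only [Set.mem_Ioi]; linarith) (by simp only [Set.mem_Ioi]; linarith)
    (by linarith) (by linarith)
  rw [show t + 1 + 1 - (t + 1) = 1 by ring, show t + s + 1 + 1 - (t + 1 + 1) = s by ring,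
    div_one, le_div_iff₀ hs] at h1
  have h2 := hrec (t + 1) (by linarith)
  have h3 := driftApprox_le_sum_log n hθ (x := t + 1) (by linarith)
  have h4 := (freeEnergyApprox_step n hθ ht0 hs.le).2
  have h5 := monotoneOn_driftApprox n hθ (a := t + s) (b := t + 1)
    (by simp only [Set.mem_Ioi]; linarith) (by simp only [Set.mem_Ioi]; linarith) (by linarith)
  have h6 : driftApprox n θ (t + s) * s ≤ (f (t + 1 + 1) - f (t + 1) + Real.log (n + 1)) * s :=
    mul_le_mul_of_nonneg_right (by linarith) hs.le
  linarith

lemma log_add_sub_log_add_le {x y r : ℝ} (hx : 0 < x) (hxy : x ≤ y) (hr : 0 ≤ r) :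
    Real.log (y + r) - Real.log (x + r) ≤ Real.log y - Real.log x := by
  have hy := hx.trans_le hxy
  have : Real.log (y + r) + Real.log x ≤ Real.log (x + r) + Real.log y := by
    rw [← Real.log_mul (by positivity) (by positivity),
      ← Real.log_mul (by positivity) (by positivity)]
    exact Real.log_le_log (by positivity) (by nlinarith)
  linarith

lemma sum_log_sub_le (n : ℕ) {x y : ℝ} (hθ : 0 ≤ θ) (hx : 0 < x) (hxy : x ≤ y) :
    ∑ j ∈ Finset.range n, Real.log (y + j * θ) - ∑ j ∈ Finset.range n, Real.log (x + j * θ)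
      ≤ n * (Real.log y - Real.log x) := by
  rw [← Finset.sum_sub_distrib]
  have h : ∀ j ∈ Finset.range n,
      Real.log (y + j * θ) - Real.log (x + j * θ) ≤ Real.log y - Real.log x := fun j _ =>
    log_add_sub_log_add_le hx hxy (by positivity)
  simpa [mul_sub] using Finset.sum_le_sum h

/-- A convex function with increments `∑ j < n, ln (t + j θ)` follows `freeEnergyApprox`. -/
lemma abs_sub_freeEnergyApprox_le (hθ : 0 < θ) (hf : ConvexOn ℝ (Set.Ioi 0) f)
    (hrec : ∀ t, 0 < t → f (t + 1) = f t + ∑ j ∈ Finset.range n, Real.log (t + j * θ))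
    {x y : ℝ} (hx : θ ≤ x) (hxy : x ≤ y) :
    |f y - f x - (freeEnergyApprox n θ y - freeEnergyApprox n θ x)|
      ≤ (y - x) * Real.log (n + 1) + 2 * n * (Real.log y - Real.log x) := by
  have hx0 : 0 < x := hθ.trans_le hx
  have hy0 : 0 < y := hx0.trans_le hxy
  have h1 := antitoneOn_sub_freeEnergyApprox hθ hf hrec hx (Set.mem_Ici.2 (hx.trans hxy)) hxy
  have h2 := antitoneOn_freeEnergyApprox_sub hθ hf hrec hx (Set.mem_Ici.2 (hx.trans hxy)) hxy
  simp only at h1 h2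
  -- Undoing the shift by two costs two differences of sums of logarithms, each at most `n * (ln y -
  -- ln x)`.
  rw [hrec (y + 1) (by linarith), hrec (x + 1) (by linarith), hrec y hy0, hrec x hx0] at h2
  have h3 := sum_log_sub_le n hθ.le hx0 hxy
  have h4 := sum_log_sub_le n hθ.le (x := x + 1) (y := y + 1) (by linarith) (by linarith)
  have h5 : Real.log (y + 1) - Real.log (x + 1) ≤ Real.log y - Real.log x :=
    log_add_sub_log_add_le hx0 hxy zero_le_one
  have h6 : (n : ℝ) * (Real.log (y + 1) - Real.log (x + 1)) ≤ n * (Real.log y - Real.log x) :=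
    mul_le_mul_of_nonneg_left h5 (Nat.cast_nonneg n)
  have h7 : Real.log x ≤ Real.log y := Real.log_le_log hx0 hxy
  have h8 : 0 ≤ Real.log ((n : ℝ) + 1) := Real.log_nonneg (by linarith [Nat.cast_nonneg (α := ℝ) n])
  have h9 : 0 ≤ (y - x) * Real.log (n + 1) := mul_nonneg (by linarith) h8
  have h10 : 0 ≤ (n : ℝ) * (Real.log y - Real.log x) :=
    mul_nonneg (Nat.cast_nonneg n) (by linarith)
  rw [abs_le]
  constructor <;> linarith

end convex

/-! ### The tilted gas and its scaling -/

/-- The Boltzmann weight with interaction strength `2θ`, wall exponent `b - 1` and decay rate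
`κ`. -/
def gasWeight (n : ℕ) (θ b κ : ℝ) : (Fin n → ℝ) → ℝ :=
  (configurations n).indicator fun x =>
    Real.exp (θ * ∑ p ∈ (Finset.univ : Finset (Fin n)).offDiag, Real.log |x p.1 - x p.2|
      + (b - 1) * ∑ i, Real.log (x i) - κ * ∑ i, x i)

lemma measurable_gasWeight (n : ℕ) (θ b κ : ℝ) : Measurable (gasWeight n θ b κ) :=
  Measurable.indicator (by fun_prop) (isOpen_configurations n).measurableSet

/-- The `1 / n` corrections in `alpha` become the `β / 2` in the wall exponent and the `-1` in `b -
1`; thus `b` stays positive up to and including `s = s_c`. -/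
lemma boltzmannWeight_mul_tilt {β c : ℝ} (hβ : 0 < β) {n : ℕ} (hn : 1 ≤ n) (s w : ℝ)
    (x : Fin n → ℝ) :
    boltzmannWeight β c n x * tilt β n s w x
      = gasWeight n (β / 2) (β * n * (sCrit c - s) + β / 2) (β * n / 2 * (1 + 2 * w)) x := by
  have hn' : (n : ℝ) ≠ 0 := by positivity
  unfold boltzmannWeight gasWeight
  by_cases hx : x ∈ configurations n
  · rw [Set.indicator_of_mem hx, Set.indicator_of_mem hx, tilt, ← Real.exp_add]
    congr 1
    simp only [energy, potential, logDet, scaledTrace, alpha, sCrit, Finset.sum_sub_distrib,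
      ← Finset.mul_sum, ← Finset.sum_div]
    field_simp
    ring
  · simp [Set.indicator_of_notMem hx]

lemma boltzmannWeight_eq_gasWeight {β c : ℝ} (hβ : 0 < β) {n : ℕ} (hn : 1 ≤ n) :
    boltzmannWeight β c n = gasWeight n (β / 2) (β * n * sCrit c + β / 2) (β * n / 2) := by
  funext x
  have h := boltzmannWeight_mul_tilt (c := c) hβ hn 0 0 x
  simpa [tilt] using h

lemma gasWeight_one {n : ℕ} {θ : ℝ} (hθ : 0 < θ) (b : ℝ) :
    gasWeight n θ b 1 = (Set.univ.pi fun _ : Fin n => Set.Ioi (0 : ℝ)).indicator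
      fun x => interaction n θ 0 x * gammaProd n b x := by
  funext x
  by_cases hx : ∀ i, 0 < x i
  · rw [Set.indicator_of_mem (show x ∈ Set.univ.pi fun _ : Fin n => Set.Ioi (0 : ℝ) from
      fun i _ => hx i)]
    by_cases hinj : Function.Injective x
    · rw [gasWeight, Set.indicator_of_mem (show x ∈ configurations n from ⟨hx, hinj⟩),
        gammaProd_eq_exp b hx]
      have : interaction n θ 0 x
          = Real.exp (θ * ∑ p ∈ (Finset.univ : Finset (Fin n)).offDiag,
            Real.log |x p.1 - x p.2|) := by
        rw [Finset.mul_sum, Real.exp_sum]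
        refine Finset.prod_congr rfl fun p hp => ?_
        have hne : x p.1 - x p.2 ≠ 0 :=
          sub_ne_zero.2 (hinj.ne (Finset.mem_offDiag.1 hp).2.2)
        rw [add_zero, Real.rpow_def_of_pos (by positivity), Real.log_pow, Real.log_abs]
        congr 1
        push_cast
        ring
      rw [this, ← Real.exp_add]
      congr 1
      ring
    · rw [gasWeight, Set.indicator_of_notMem fun h => hinj h.2]
      obtain ⟨i, j, hij, hne⟩ : ∃ i j, x i = x j ∧ i ≠ j := by
        simpa [Function.Injective] using hinj
      rw [interaction_eq_zero hθ hne hij, zero_mul]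
  · rw [gasWeight, Set.indicator_of_notMem fun h => hx h.1, Set.indicator_of_notMem
      fun h : x ∈ Set.univ.pi fun _ : Fin n => Set.Ioi (0 : ℝ) => hx fun i => h i (Set.mem_univ i)]

lemma integrable_gasWeight_one (n : ℕ) {θ b : ℝ} (hθ : 0 < θ) (hb : 0 < b) :
    Integrable (gasWeight n θ b 1) := by
  rw [gasWeight_one hθ, integrable_indicator_iff (MeasurableSet.univ_pi fun _ => measurableSet_Ioi),
    IntegrableOn, ← orthant_eq_restrict]
  exact integrable_interaction_gammaProd n hθ.le hb

lemma integral_gasWeight_one (n : ℕ) {θ : ℝ} (hθ : 0 < θ) (b : ℝ) :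
    ∫ x, gasWeight n θ b 1 x = laguerreIntegral n θ b := by
  rw [gasWeight_one hθ, integral_indicator (MeasurableSet.univ_pi fun _ => measurableSet_Ioi),
    ← orthant_eq_restrict, laguerreIntegral]

lemma smul_mem_configurations_iff {n : ℕ} {κ : ℝ} (hκ : 0 < κ) (x : Fin n → ℝ) :
    κ • x ∈ configurations n ↔ x ∈ configurations n := by
  refine and_congr (forall_congr' fun i => ?_) ⟨fun h i j hij => h ?_, fun h i j hij => h ?_⟩
  · simp [hκ]
  · simp [hij]
  · simpa [hκ.ne'] using hij

/-- Homogeneity: each of the `n (n - 1)` ordered pairs contributes `θ` to the degree and each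
particle `b - 1`. The Jacobian later turns `b - 1` into `b`. -/
lemma gasWeight_eq_smul (n : ℕ) (θ b : ℝ) {κ : ℝ} (hκ : 0 < κ) (x : Fin n → ℝ) :
    gasWeight n θ b κ x
      = Real.exp (-((n : ℝ) * (b - 1) + n * (n - 1) * θ) * Real.log κ)
        * gasWeight n θ b 1 (κ • x) := by
  unfold gasWeight
  by_cases hx : x ∈ configurations n
  · rw [Set.indicator_of_mem hx, Set.indicator_of_mem ((smul_mem_configurations_iff hκ x).2 hx),
      ← Real.exp_add]
    congr 1
    have h1 : ∑ i, Real.log ((κ • x) i) = n * Real.log κ + ∑ i, Real.log (x i) := by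
      have : ∀ i, Real.log ((κ • x) i) = Real.log κ + Real.log (x i) := fun i => by
        rw [Pi.smul_apply, smul_eq_mul, Real.log_mul hκ.ne' (hx.1 i).ne']
      simp only [this, Finset.sum_add_distrib, Finset.sum_const, Finset.card_univ,
        Fintype.card_fin, nsmul_eq_mul]
    have h2 : ∑ p ∈ (Finset.univ : Finset (Fin n)).offDiag, Real.log |(κ • x) p.1 - (κ • x) p.2|
        = n * (n - 1) * Real.log κ
          + ∑ p ∈ (Finset.univ : Finset (Fin n)).offDiag, Real.log |x p.1 - x p.2| := by
      have : ∀ p ∈ (Finset.univ : Finset (Fin n)).offDiag,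
          Real.log |(κ • x) p.1 - (κ • x) p.2| = Real.log κ + Real.log |x p.1 - x p.2| := by
        intro p hp
        have hne : x p.1 - x p.2 ≠ 0 :=
          sub_ne_zero.2 (hx.2.ne (Finset.mem_offDiag.1 hp).2.2)
        rw [Pi.smul_apply, Pi.smul_apply, ← smul_sub, smul_eq_mul, Real.log_abs, Real.log_abs,
          Real.log_mul hκ.ne' hne]
      rw [Finset.sum_congr rfl this, Finset.sum_add_distrib, Finset.sum_const, Finset.offDiag_card,
        Finset.card_univ, Fintype.card_fin, nsmul_eq_mul, Nat.cast_sub (Nat.le_mul_self n)]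
      push_cast
      ring
    have h3 : ∑ i, (κ • x) i = κ * ∑ i, x i := by
      simp [Finset.mul_sum]
    rw [h1, h2, h3]
    ring
  · rw [Set.indicator_of_notMem hx,
      Set.indicator_of_notMem fun h => hx ((smul_mem_configurations_iff hκ x).1 h), mul_zero]

lemma integrable_gasWeight (n : ℕ) {θ b κ : ℝ} (hθ : 0 < θ) (hb : 0 < b) (hκ : 0 < κ) :
    Integrable (gasWeight n θ b κ) := by
  rw [funext (gasWeight_eq_smul n θ b hκ)]
  exact ((integrable_gasWeight_one n hθ hb).comp_smul hκ.ne').const_mul _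

lemma integral_gasWeight (n : ℕ) {θ κ : ℝ} (hθ : 0 < θ) (b : ℝ) (hκ : 0 < κ) :
    ∫ x, gasWeight n θ b κ x
      = Real.exp (-((n : ℝ) * b + n * (n - 1) * θ) * Real.log κ) * laguerreIntegral n θ b := by
  rw [funext (gasWeight_eq_smul n θ b hκ), integral_const_mul,
    Measure.integral_comp_smul_of_nonneg volume (gasWeight n θ b 1) κ (hR := hκ.le),
    integral_gasWeight_one n hθ, Module.finrank_fin_fun, smul_eq_mul, ← mul_assoc]
  congr 1
  rw [← Real.rpow_natCast, Real.rpow_def_of_pos hκ, ← Real.exp_neg, ← Real.exp_add]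
  congr 1
  ring

lemma integral_gasWeight_pos (n : ℕ) {θ b κ : ℝ} (hθ : 0 < θ) (hb : 0 < b) (hκ : 0 < κ) :
    0 < ∫ x, gasWeight n θ b κ x := by
  rw [integral_gasWeight n hθ b hκ]
  exact mul_pos (Real.exp_pos _) (laguerreIntegral_pos n hθ.le hb)

lemma log_integral_gasWeight (n : ℕ) {θ b κ : ℝ} (hθ : 0 < θ) (hb : 0 < b) (hκ : 0 < κ) :
    Real.log (∫ x, gasWeight n θ b κ x)
      = Real.log (laguerreIntegral n θ b) - ((n : ℝ) * b + n * (n - 1) * θ) * Real.log κ := by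
  rw [integral_gasWeight n hθ b hκ, Real.log_mul (Real.exp_pos _).ne'
    (laguerreIntegral_pos n hθ.le hb).ne', Real.log_exp]
  ring

/-! ### The eigenvalue law and its Laplace transform -/

section law

variable {β c : ℝ} {n : ℕ}

lemma wallExponent_pos (hβ : 0 < β) {u : ℝ} (hu : 0 ≤ u) (n : ℕ) : 0 < β * n * u + β / 2 := by
  positivity

lemma sCrit_nonneg (hc : 1 ≤ c) : 0 ≤ sCrit c := by
  unfold sCrit; linarith

lemma measurable_boltzmannWeight (hβ : 0 < β) (hn : 1 ≤ n) : Measurable (boltzmannWeight β c n) := by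
  rw [boltzmannWeight_eq_gasWeight hβ hn]; exact measurable_gasWeight _ _ _ _

lemma boltzmannWeight_nonneg (x : Fin n → ℝ) : 0 ≤ boltzmannWeight β c n x :=
  Set.indicator_nonneg (fun _ _ => (Real.exp_pos _).le) x

lemma integrable_boltzmannWeight (hβ : 0 < β) (hc : 1 ≤ c) (hn : 1 ≤ n) :
    Integrable (boltzmannWeight β c n) := by
  have hn' : (0 : ℝ) < n := by exact_mod_cast hn
  rw [boltzmannWeight_eq_gasWeight hβ hn]
  exact integrable_gasWeight n (by positivity) (wallExponent_pos hβ (sCrit_nonneg hc) n)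
    (by positivity)

lemma integral_boltzmannWeight_pos (hβ : 0 < β) (hc : 1 ≤ c) (hn : 1 ≤ n) :
    0 < ∫ x, boltzmannWeight β c n x := by
  have hn' : (0 : ℝ) < n := by exact_mod_cast hn
  rw [boltzmannWeight_eq_gasWeight hβ hn]
  exact integral_gasWeight_pos n (by positivity) (wallExponent_pos hβ (sCrit_nonneg hc) n)
    (by positivity)

lemma partitionFunction_eq (hβ : 0 < β) (hc : 1 ≤ c) (hn : 1 ≤ n) :
    partitionFunction β c n = ENNReal.ofReal (∫ x, boltzmannWeight β c n x) :=
  (ofReal_integral_eq_lintegral_ofReal (integrable_boltzmannWeight hβ hc hn)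
    (Eventually.of_forall boltzmannWeight_nonneg)).symm

lemma isProbabilityMeasure_eigenvalueLaw (hβ : 0 < β) (hc : 1 ≤ c) (hn : 1 ≤ n) :
    IsProbabilityMeasure (eigenvalueLaw β c n) := by
  refine ⟨?_⟩
  rw [eigenvalueLaw, Measure.smul_apply, withDensity_apply _ MeasurableSet.univ,
    Measure.restrict_univ, smul_eq_mul]
  change (partitionFunction β c n)⁻¹ * partitionFunction β c n = 1
  rw [partitionFunction_eq hβ hc hn]
  exact ENNReal.inv_mul_cancel
    (ENNReal.ofReal_pos.2 (integral_boltzmannWeight_pos hβ hc hn)).ne' ENNReal.ofReal_ne_top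

lemma integrable_tilt (hβ : 0 < β) (hc : 1 ≤ c) (hn : 1 ≤ n) {s w : ℝ} (hs : s ≤ sCrit c)
    (hw : -(1 / 2) < w) : Integrable (tilt β n s w) (eigenvalueLaw β c n) := by
  have hn' : (0 : ℝ) < n := by exact_mod_cast hn
  refine Integrable.smul_measure ?_ ?_
  · rw [integrable_withDensity_iff_integrable_smul'
      (measurable_boltzmannWeight hβ hn).ennreal_ofReal (by simp)]
    have : (fun x => (ENNReal.ofReal (boltzmannWeight β c n x)).toReal • tilt β n s w x)
        = gasWeight n (β / 2) (β * n * (sCrit c - s) + β / 2) (β * n / 2 * (1 + 2 * w)) := by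
      funext x
      rw [ENNReal.toReal_ofReal (boltzmannWeight_nonneg x), smul_eq_mul,
        boltzmannWeight_mul_tilt hβ hn]
    rw [this]
    have hw' : 0 < 1 + 2 * w := by linarith
    exact integrable_gasWeight n (by positivity) (wallExponent_pos hβ (sub_nonneg.2 hs) n)
      (by positivity)
  · rw [partitionFunction_eq hβ hc hn]
    exact ENNReal.inv_ne_top.2 (ENNReal.ofReal_pos.2 (integral_boltzmannWeight_pos hβ hc hn)).ne'

lemma laplace_eq_div (hβ : 0 < β) (hc : 1 ≤ c) (hn : 1 ≤ n) (s w : ℝ) :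
    laplace β c n s w
      = (∫ x, gasWeight n (β / 2) (β * n * (sCrit c - s) + β / 2) (β * n / 2 * (1 + 2 * w)) x)
        / ∫ x, gasWeight n (β / 2) (β * n * sCrit c + β / 2) (β * n / 2) x := by
  rw [laplace, eigenvalueLaw, integral_smul_measure, integral_withDensity_eq_integral_toReal_smul
    (measurable_boltzmannWeight hβ hn).ennreal_ofReal (by simp), partitionFunction_eq hβ hc hn,
    ENNReal.toReal_inv, ENNReal.toReal_ofReal (integral_boltzmannWeight_pos hβ hc hn).le,
    ← boltzmannWeight_eq_gasWeight hβ hn, smul_eq_mul, div_eq_inv_mul]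
  congr 2
  funext x
  rw [ENNReal.toReal_ofReal (boltzmannWeight_nonneg x), smul_eq_mul,
    boltzmannWeight_mul_tilt hβ hn]

/-- For `b = β n (s_c - s) + β / 2` the scaling degree `n b + n (n - 1) β / 2` is exactly `β n ^ 2
(c / 2 - s)`, so the dependence on `w` is explicit without any limit. -/
lemma scaledLogLaplace_eq (hβ : 0 < β) (hc : 1 ≤ c) (hn : 1 ≤ n) {s w : ℝ} (hs : s ≤ sCrit c)
    (hw : -(1 / 2) < w) :
    scaledLogLaplace β c n s w
      = -(Real.log (laguerreIntegral n (β / 2) (β * n * (sCrit c - s) + β / 2))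
          - Real.log (laguerreIntegral n (β / 2) (β * n * sCrit c + β / 2))) / (β * n ^ 2)
        + (c / 2 - s) * Real.log (1 + 2 * w) - s * Real.log (β * n / 2) := by
  have hn' : (0 : ℝ) < n := by exact_mod_cast hn
  have hw' : 0 < 1 + 2 * w := by linarith
  have hθ : 0 < β / 2 := by positivity
  have hb := wallExponent_pos hβ (sub_nonneg.2 hs) n
  have ha := wallExponent_pos hβ (sCrit_nonneg hc) n
  have hκ : 0 < β * n / 2 := by positivity
  have hκ' : 0 < β * n / 2 * (1 + 2 * w) := by positivity
  rw [scaledLogLaplace, laplace_eq_div hβ hc hn, Real.log_div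
    (integral_gasWeight_pos n hθ hb hκ').ne' (integral_gasWeight_pos n hθ ha hκ).ne',
    log_integral_gasWeight n hθ hb hκ', log_integral_gasWeight n hθ ha hκ,
    Real.log_mul hκ.ne' hw'.ne']
  generalize Real.log (laguerreIntegral n (β / 2) (β * n * (sCrit c - s) + β / 2)) = A
  generalize Real.log (laguerreIntegral n (β / 2) (β * n * sCrit c + β / 2)) = B
  unfold sCrit
  field_simp
  ring

end law

/-! ### Large `n` asymptotics -/

lemma abs_sub_freeEnergyApprox_le_abs {n : ℕ} {θ : ℝ} {f : ℝ → ℝ} (hθ : 0 < θ)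
    (hf : ConvexOn ℝ (Set.Ioi 0) f)
    (hrec : ∀ t, 0 < t → f (t + 1) = f t + ∑ j ∈ Finset.range n, Real.log (t + j * θ))
    {x y : ℝ} (hx : θ ≤ x) (hy : θ ≤ y) :
    |f y - f x - (freeEnergyApprox n θ y - freeEnergyApprox n θ x)|
      ≤ |y - x| * Real.log (n + 1) + 2 * n * |Real.log y - Real.log x| := by
  rcases le_total x y with h | h
  · have := abs_sub_freeEnergyApprox_le hθ hf hrec hx h
    rwa [abs_of_nonneg (sub_nonneg.2 h),
      abs_of_nonneg (sub_nonneg.2 (Real.log_le_log (hθ.trans_le hx) h))]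
  · have := abs_sub_freeEnergyApprox_le hθ hf hrec hy h
    rw [abs_sub_comm y x, abs_sub_comm (Real.log y), abs_of_nonneg (sub_nonneg.2 h),
      abs_of_nonneg (sub_nonneg.2 (Real.log_le_log (hθ.trans_le hy) h))]
    rw [← abs_neg]
    convert this using 2
    ring

lemma log_laguerreIntegral_add_one (n : ℕ) {θ : ℝ} (hθ : 0 < θ) {t : ℝ} (ht : 0 < t) :
    Real.log (laguerreIntegral n θ (t + 1))
      = Real.log (laguerreIntegral n θ t) + ∑ j ∈ Finset.range n, Real.log (t + j * θ) := by
  have h : ∀ j ∈ Finset.range n, t + (j : ℝ) * θ ≠ 0 := fun j _ => by positivity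
  rw [laguerreIntegral_add_one n hθ ht, Real.log_mul (Finset.prod_ne_zero_iff.2 h)
    (laguerreIntegral_pos n hθ.le ht).ne', Real.log_prod h, add_comm]

lemma logPrimTwo_mul {κ y : ℝ} (hκ : 0 < κ) (hy : 0 < y) :
    logPrimTwo (κ * y) = κ ^ 2 * (logPrimTwo y + y ^ 2 / 2 * Real.log κ) := by
  rw [logPrimTwo, logPrimTwo, Real.log_mul hκ.ne' hy.ne']
  ring

/-- Everything is rescaled by `β n / 2`. The logarithm of this scale has a coefficient affine in
`u`, so a difference between `u` and `v` leaves `(u - v) * ln (β n / 2)`. -/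
lemma freeEnergyApprox_wallExponent {β : ℝ} (hβ : 0 < β) {n : ℕ} (hn : 1 ≤ n) {u : ℝ}
    (hu : 0 ≤ u) :
    freeEnergyApprox n (β / 2) (β * n * u + β / 2)
      = β * n ^ 2 * ((logPrimTwo (2 * u + 1 / n + 1) - logPrimTwo (2 * u + 1 / n)) / 2
        + ((2 * u + 1 / n) / 2 + 1 / 4) * Real.log (β * n / 2)) := by
  have hn' : (0 : ℝ) < n := by exact_mod_cast hn
  have hκ : 0 < β * n / 2 := by positivity
  have e1 : β * n * u + β / 2 = β * n / 2 * (2 * u + 1 / n) := by field_simp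
  have e2 : β * n * u + β / 2 + n * (β / 2) = β * n / 2 * (2 * u + 1 / n + 1) := by
    field_simp
  rw [freeEnergyApprox, e2, e1, logPrimTwo_mul hκ (by positivity),
    logPrimTwo_mul hκ (by positivity)]
  generalize logPrimTwo (2 * u + 1 / n + 1) = A
  generalize logPrimTwo (2 * u + 1 / n) = B
  generalize Real.log (β * n / 2) = C
  field_simp
  ring

lemma continuous_logPrimTwo : Continuous logPrimTwo := by
  -- This form is continuous at `0` too, which is what covers `s = s_c` and `c = 1`.
  have : logPrimTwo = fun x => x / 2 * (x * Real.log x) - 3 / 4 * x ^ 2 := by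
    funext x; rw [logPrimTwo]; ring
  rw [this]
  have := Real.continuous_mul_log
  fun_prop

/-- Identifies `phi` with an increment of the second primitive; the constant `3 / 8` drops out of
all differences. -/
lemma phi_neg (u : ℝ) :
    phi (-u) = -(logPrimTwo (2 * u + 1) - logPrimTwo (2 * u)) / 2 - 3 / 8 := by
  have e1 : -2 * -u = 2 * u := by ring
  have e2 : 1 - 2 * -u = 2 * u + 1 := by ring
  rw [phi, logPrimTwo, logPrimTwo, e1, e2]
  ring

lemma tendsto_logPrimTwo_increment (u : ℝ) :
    Tendsto (fun n : ℕ => logPrimTwo (2 * u + 1 / (n : ℝ) + 1) - logPrimTwo (2 * u + 1 / (n : ℝ)))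
      atTop (𝓝 (logPrimTwo (2 * u + 1) - logPrimTwo (2 * u))) := by
  have h : Tendsto (fun n : ℕ => 2 * u + 1 / (n : ℝ)) atTop (𝓝 (2 * u + 0)) :=
    tendsto_const_nhds.add tendsto_one_div_atTop_nhds_zero_nat
  rw [add_zero] at h
  exact ((continuous_logPrimTwo.tendsto _).comp (h.add_const 1)).sub
    ((continuous_logPrimTwo.tendsto _).comp h)

lemma tendsto_log_add_one_div : Tendsto (fun n : ℕ => Real.log ((n : ℝ) + 1) / n) atTop (𝓝 0) := by
  have h := (Real.tendsto_pow_log_div_mul_add_atTop 1 (-1) 1 one_ne_zero).comp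
    (tendsto_atTop_add_const_right _ (1 : ℝ) tendsto_natCast_atTop_atTop)
  refine h.congr fun n => ?_
  simp

lemma log_wallExponent_bounds {β : ℝ} (hβ : 0 < β) {u : ℝ} (hu : 0 ≤ u) (n : ℕ) :
    Real.log (β / 2) ≤ Real.log (β * n * u + β / 2) ∧
      Real.log (β * n * u + β / 2)
        ≤ Real.log (β / 2) + Real.log (2 * u + 1) + Real.log (n + 1) := by
  have hn : (0 : ℝ) ≤ n := Nat.cast_nonneg n
  have h0 : 0 ≤ β * n * u := by positivity
  refine ⟨Real.log_le_log (by positivity) (by linarith), ?_⟩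
  rw [← Real.log_mul (by positivity) (by positivity), ← Real.log_mul (by positivity) (by positivity)]
  refine Real.log_le_log (by positivity) ?_
  have : 0 ≤ β * u := by positivity
  nlinarith [mul_nonneg hβ.le hn]

/-- The comparison error is `O(n ln n)`: the parameters differ by `β n |u - v|`, and their
logarithms by `O(ln (n + 1))` plus a constant, even when one of `u`, `v` is `0`. -/
lemma tendsto_log_laguerreIntegral_increment {β : ℝ} (hβ : 0 < β) {u v : ℝ} (hu : 0 ≤ u)
    (hv : 0 ≤ v) :
    Tendsto (fun n : ℕ =>
      (Real.log (laguerreIntegral n (β / 2) (β * n * u + β / 2))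
          - Real.log (laguerreIntegral n (β / 2) (β * n * v + β / 2))) / (β * n ^ 2)
        - (u - v) * Real.log (β * n / 2)) atTop (𝓝 (phi (-v) - phi (-u))) := by
  have hθ : 0 < β / 2 := by positivity
  set g : ℕ → ℝ → ℝ := fun n t => Real.log (laguerreIntegral n (β / 2) t) with hg
  set E : ℕ → ℝ := fun n =>
    g n (β * n * u + β / 2) - g n (β * n * v + β / 2)
      - (freeEnergyApprox n (β / 2) (β * n * u + β / 2)
        - freeEnergyApprox n (β / 2) (β * n * v + β / 2)) with hE
  set C := Real.log (2 * u + 1) + Real.log (2 * v + 1) with hC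
  have hbound : ∀ n : ℕ, 1 ≤ n → |E n / (β * n ^ 2)|
      ≤ (|u - v| + 2 / β) * (Real.log ((n : ℝ) + 1) / n) + 2 * C / β * (1 / (n : ℝ)) := by
    intro n hn
    have hn' : (0 : ℝ) < n := by exact_mod_cast hn
    have hlow : ∀ t : ℝ, 0 ≤ t → β / 2 ≤ β * n * t + β / 2 := fun t ht => by
      have : 0 ≤ β * n * t := by positivity
      linarith
    have h1 := abs_sub_freeEnergyApprox_le_abs hθ (convexOn_log_laguerreIntegral n hθ.le)
      (fun t ht => log_laguerreIntegral_add_one n hθ ht) (hlow v hv) (hlow u hu)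
    have h2 : |β * n * u + β / 2 - (β * n * v + β / 2)| = β * n * |u - v| := by
      rw [show β * n * u + β / 2 - (β * n * v + β / 2) = β * n * (u - v) by ring, abs_mul,
        abs_of_pos (by positivity : 0 < β * n)]
    have h3 : |Real.log (β * n * u + β / 2) - Real.log (β * n * v + β / 2)|
        ≤ C + Real.log (n + 1) := by
      have bu := log_wallExponent_bounds hβ hu n
      have bv := log_wallExponent_bounds hβ hv n
      have pu : 0 ≤ Real.log (2 * u + 1) := Real.log_nonneg (by linarith)
      have pv : 0 ≤ Real.log (2 * v + 1) := Real.log_nonneg (by linarith)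
      rw [abs_le]
      constructor <;> linarith
    rw [h2] at h1
    have h4 : |E n| ≤ β * n * |u - v| * Real.log (n + 1) + 2 * n * (C + Real.log (n + 1)) :=
      h1.trans (by gcongr)
    rw [abs_div, abs_of_pos (by positivity : 0 < β * (n : ℝ) ^ 2), div_le_iff₀ (by positivity)]
    refine h4.trans (le_of_eq ?_)
    field_simp
    ring
  have hE0 : Tendsto (fun n : ℕ => E n / (β * n ^ 2)) atTop (𝓝 0) := by
    refine squeeze_zero_norm' (eventually_atTop.2 ⟨1, hbound⟩) ?_
    simpa using (tendsto_log_add_one_div.const_mul (|u - v| + 2 / β)).add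
      (tendsto_one_div_atTop_nhds_zero_nat.const_mul (2 * C / β))
  have hlim := hE0.add (((tendsto_logPrimTwo_increment u).sub
    (tendsto_logPrimTwo_increment v)).div_const 2)
  have hval : 0 + (logPrimTwo (2 * u + 1) - logPrimTwo (2 * u)
      - (logPrimTwo (2 * v + 1) - logPrimTwo (2 * v))) / 2 = phi (-v) - phi (-u) := by
    rw [phi_neg, phi_neg]; ring
  rw [hval] at hlim
  refine hlim.congr' ?_
  filter_upwards [eventually_ge_atTop 1] with n hn
  have hn' : (0 : ℝ) < n := by exact_mod_cast hn
  simp only [hE]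
  rw [freeEnergyApprox_wallExponent hβ hn hu, freeEnergyApprox_wallExponent hβ hn hv]
  field_simp
  ring

/-- Here `u = s_c - s` and `v = s_c`, so `u - v = -s`, and the divergent logarithm matches the term
`-s * ln (β n / 2)` from the rescaling. -/
lemma tendsto_scaledLogLaplace {β c : ℝ} (hβ : 0 < β) (hc : 1 ≤ c) {s w : ℝ} (hs : s ≤ sCrit c)
    (hw : -(1 / 2) < w) :
    Tendsto (fun n : ℕ => scaledLogLaplace β c n s w) atTop
      (𝓝 (JH c s + JT c w - s * Real.log (1 + 2 * w))) := by
  have h := ((tendsto_log_laguerreIntegral_increment hβ (sub_nonneg.2 hs) (sCrit_nonneg hc)).neg).add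
    (tendsto_const_nhds (x := (c / 2 - s) * Real.log (1 + 2 * w)))
  have hval : -(phi (-sCrit c) - phi (-(sCrit c - s))) + (c / 2 - s) * Real.log (1 + 2 * w)
      = JH c s + JT c w - s * Real.log (1 + 2 * w) := by
    rw [JH, JT, neg_sub (sCrit c) s]; ring
  rw [hval] at h
  refine h.congr' ?_
  filter_upwards [eventually_ge_atTop 1] with n hn
  rw [scaledLogLaplace_eq hβ hc hn hs hw]
  ring

end LaguerreGas

end

theorem theorem1 (β c : ℝ) (hβ : 0 < β) (hc : 1 ≤ c) :
    (∀ n : ℕ, 1 ≤ n → IsProbabilityMeasure (LaguerreGas.eigenvalueLaw β c n)) ∧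
    (∀ s w : ℝ, s ≤ LaguerreGas.sCrit c → -(1 / 2) < w →
      (∀ n : ℕ, 1 ≤ n →
        Integrable (LaguerreGas.tilt β n s w) (LaguerreGas.eigenvalueLaw β c n)) ∧
      Tendsto (fun n : ℕ => LaguerreGas.scaledLogLaplace β c n s w) atTop
        (𝓝 (LaguerreGas.JH c s + LaguerreGas.JT c w - s * Real.log (1 + 2 * w)))) ∧
    (∀ s : ℝ, s ≤ LaguerreGas.sCrit c →
      Tendsto (fun n : ℕ => LaguerreGas.scaledLogLaplace β c n s 0) atTop
        (𝓝 (LaguerreGas.JH c s))) ∧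
    (∀ w : ℝ, -(1 / 2) < w →
      Tendsto (fun n : ℕ => LaguerreGas.scaledLogLaplace β c n 0 w) atTop
        (𝓝 (LaguerreGas.JT c w))) := by
  refine ⟨fun n hn => LaguerreGas.isProbabilityMeasure_eigenvalueLaw hβ hc hn,
    fun s w hs hw => ⟨fun n hn => LaguerreGas.integrable_tilt hβ hc hn hs hw,
      LaguerreGas.tendsto_scaledLogLaplace hβ hc hs hw⟩, fun s hs => ?_, fun w hw => ?_⟩
  · simpa [LaguerreGas.JT] using
      LaguerreGas.tendsto_scaledLogLaplace hβ hc hs (w := 0) (by norm_num)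
  · simpa [LaguerreGas.JH] using
      LaguerreGas.tendsto_scaledLogLaplace hβ hc (LaguerreGas.sCrit_nonneg hc) hw
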